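/- Let $M,a\in\mathbb R$ with $|a|<M$, and let $(K,g)$ be the domain of outer communication $\{r>M+\sqrt{M^2-a^2}\}$ (axis included) of the subcritical Kerr spacetime of mass $M$ and rotation parameter $a$: as a manifold $K=\mathbb R_t\times\{X\in\mathbb R^3:|X|>M+\sqrt{M^2-a^2}\}$ with $X=(r\sin\vartheta\cos\varphi,\,r\sin\vartheta\sin\varphi,\,r\cos\vartheta)$, and $g$ is the smooth extension across the axis $\{\sin\vartheta=0\}$ of the Boyer--Lindquist metric $$-\Big(1-\frac{2Mr}{\rho^2}\Big)dt^2+\frac{\rho^2}{\Delta}dr^2+\rho^2d\vartheta^2-\frac{4Mra\sin^2\vartheta}{\rho^2}\,dt\,d\varphi+\frac{\mathscr A}{\rho^2}\sin^2\vartheta\,d\varphi^2,$$ where $\rho^2=r^2+a^2\cos^2\vartheta$, $\Delta=r^2-2Mr+a^2$, $\mathscr A=(r^2+a^2)^2-\Delta a^2\sin^2\vartheta$. A photon is an inextendible null geodesic of $(K,g)$. It is called trapped if its orbit, projected to the quotient of $K$ by the flow of the stationary Killing field $\partial_t$, is contained in a compact subset of that quotient. Let $P'\subseteq TK$ be the set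 of all $(x,p)$ such that $p$ is a nonzero future-directed null vector at $x$ and the photon $\gamma$ with $\gamma(0)=x$, $\dot\gamma(0)=p$ is trapped, and let $P\subseteq T^*K$ be the image of $P'$ under the canonical isomorphism $TK\to T^*K$, $(x,p)\mapsto(x,g_x(p,\cdot))$. Then $P'$ is a smooth embedded $5$-dimensional submanifold of $TK$, and $P$ is a smooth embedded $5$-dimensional submanifold of $T^*K$. -/

import Mathlib

open scoped ContDiff

noncomputable section

namespace Kerr

/-- The model space `ℝ⁴`. A point is `x = (t, x₁, x₂, x₃)`, where `t` is the Boyer-Lindquist time and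
`(x₁, x₂, x₃) = (r sin ϑ cos φ, r sin ϑ sin φ, r cos ϑ)` are Cartesian-type coordinates made from
the Boyer-Lindquist coordinates `r, ϑ, φ`. These coordinates are regular across the axis. -/
abbrev Coord : Type := Fin 4 → ℝ

/-- The Boyer-Lindquist radius `r`. -/
def rad (x : Coord) : ℝ := √(x 1 ^ 2 + x 2 ^ 2 + x 3 ^ 2)

/-- `ρ² = r² + a² cos² ϑ`, with `cos ϑ = x₃ / r`. -/
def rhoSq (a : ℝ) (x : Coord) : ℝ := rad x ^ 2 + a ^ 2 * (x 3 / rad x) ^ 2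

/-- `Δ = r² - 2 M r + a²`. -/
def Delta (M a : ℝ) (x : Coord) : ℝ := rad x ^ 2 - 2 * M * rad x + a ^ 2

/-- The coordinate one-form `dxᵢ`. -/
def dx (i : Fin 4) : Coord →L[ℝ] ℝ := ContinuousLinearMap.proj i

/-- The one-form `dr`. -/
def dr (x : Coord) : Coord →L[ℝ] ℝ :=
  (rad x)⁻¹ • (x 1 • dx 1 + x 2 • dx 2 + x 3 • dx 3)

/-- The one-form `sin² ϑ dφ = (x₁ dx₂ - x₂ dx₁) / r²`. -/
def sinSqDphi (x : Coord) : Coord →L[ℝ] ℝ :=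
  (rad x ^ 2)⁻¹ • (x 1 • dx 2 - x 2 • dx 1)

/-- The tensor product `α ⊗ β` of two one-forms, `(α ⊗ β)(v, w) = α(v) β(w)`. -/
def tens (α β : Coord →L[ℝ] ℝ) : Coord →L[ℝ] Coord →L[ℝ] ℝ := α.smulRight β

/-- The Kerr metric of mass `M` and rotation parameter `a`, written so that it is manifestly smooth
across the axis: with `ω = sin² ϑ dφ`,
`g = -(1 - 2Mr/ρ²) dt² + (ρ²/Δ) dr² + (ρ²/r²)(dx₁² + dx₂² + dx₃² - dr²)
      - (2Mra/ρ²)(dt ⊗ ω + ω ⊗ dt) + a²(1 + 2Mr/ρ²) ω²`.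
`metric_boyerLindquist` below shows that this is the usual Boyer-Lindquist expression. -/
def metric (M a : ℝ) (x : Coord) : Coord →L[ℝ] Coord →L[ℝ] ℝ :=
  (-(1 - 2 * M * rad x / rhoSq a x)) • tens (dx 0) (dx 0)
    + (rhoSq a x / Delta M a x) • tens (dr x) (dr x)
    + (rhoSq a x / rad x ^ 2) •
        (tens (dx 1) (dx 1) + tens (dx 2) (dx 2) + tens (dx 3) (dx 3) - tens (dr x) (dr x))
    - (2 * M * rad x * a / rhoSq a x) •
        (tens (dx 0) (sinSqDphi x) + tens (sinSqDphi x) (dx 0))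
    + (a ^ 2 * (1 + 2 * M * rad x / rhoSq a x)) • tens (sinSqDphi x) (sinSqDphi x)

/-- The map from Boyer-Lindquist coordinates `q = (t, r, ϑ, φ)` to `(t, x₁, x₂, x₃)`. -/
def boyerLindquist (q : Coord) : Coord :=
  ![q 0, q 1 * Real.sin (q 2) * Real.cos (q 3), q 1 * Real.sin (q 2) * Real.sin (q 3),
    q 1 * Real.cos (q 2)]

/-- The differential of `boyerLindquist` at `q` applied to the vector `p = (p⁰, p¹, p², p³)`. -/
def boyerLindquistDeriv (q p : Coord) : Coord :=
  ![p 0,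
    Real.sin (q 2) * Real.cos (q 3) * p 1 + q 1 * Real.cos (q 2) * Real.cos (q 3) * p 2
      - q 1 * Real.sin (q 2) * Real.sin (q 3) * p 3,
    Real.sin (q 2) * Real.sin (q 3) * p 1 + q 1 * Real.cos (q 2) * Real.sin (q 3) * p 2
      + q 1 * Real.sin (q 2) * Real.cos (q 3) * p 3,
    Real.cos (q 2) * p 1 - q 1 * Real.sin (q 2) * p 2]

lemma fderiv_boyerLindquist (q p : Coord) :
    fderiv ℝ boyerLindquist q p = boyerLindquistDeriv q p := by
  have h : ∀ i : Fin 4, HasFDerivAt (fun q : Coord => q i) (dx i) q :=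
    fun i => hasFDerivAt_apply i q
  have H : HasFDerivAt boyerLindquist (ContinuousLinearMap.pi
      (fun i => fderiv ℝ (fun y => boyerLindquist y i) q)) q := by
    rw [hasFDerivAt_pi']
    intro i
    have : DifferentiableAt ℝ (fun y => boyerLindquist y i) q := by
      fin_cases i <;> simp only [boyerLindquist] <;> simp <;> fun_prop
    exact this.hasFDerivAt
  rw [H.fderiv]
  ext i
  have h1 := ((h 1).mul (h 2).sin).mul (h 3).cos
  have h2 := ((h 1).mul (h 2).sin).mul (h 3).sin
  have h3 := (h 1).mul (h 2).cos
  fin_cases i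
  · simpa [boyerLindquist, boyerLindquistDeriv, dx] using
      congrArg (fun L : Coord →L[ℝ] ℝ => L p) (h 0).fderiv
  · refine (congrArg (fun L : Coord →L[ℝ] ℝ => L p) h1.fderiv).trans ?_
    simp [boyerLindquistDeriv, dx]; ring
  · refine (congrArg (fun L : Coord →L[ℝ] ℝ => L p) h2.fderiv).trans ?_
    simp [boyerLindquistDeriv, dx]; ring
  · refine (congrArg (fun L : Coord →L[ℝ] ℝ => L p) h3.fderiv).trans ?_
    simp [boyerLindquistDeriv, dx]; ring

/-- In Boyer-Lindquist coordinates `(t, r, ϑ, φ)` the metric is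
`-(1 - 2Mr/ρ²) dt² + (ρ²/Δ) dr² + ρ² dϑ² - (4MraS²/ρ²) dt dφ + (𝒜/ρ²) S² dφ²`, where
`S = sin ϑ`, `C = cos ϑ`, `ρ² = r² + a²C²`, `Δ = r² - 2Mr + a²`, `𝒜 = (r² + a²)² - Δ a² S²`. -/
theorem metric_boyerLindquist (M a : ℝ) (q p p' : Coord) (hr : 0 < q 1) :
    let r := q 1
    let S := Real.sin (q 2)
    let C := Real.cos (q 2)
    let ρ2 := r ^ 2 + a ^ 2 * C ^ 2
    let D := r ^ 2 - 2 * M * r + a ^ 2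
    let A := (r ^ 2 + a ^ 2) ^ 2 - D * a ^ 2 * S ^ 2
    metric M a (boyerLindquist q) (fderiv ℝ boyerLindquist q p) (fderiv ℝ boyerLindquist q p') =
      -(1 - 2 * M * r / ρ2) * (p 0 * p' 0) + ρ2 / D * (p 1 * p' 1) + ρ2 * (p 2 * p' 2)
        - 2 * M * r * a * S ^ 2 / ρ2 * (p 0 * p' 3 + p 3 * p' 0)
        + A / ρ2 * S ^ 2 * (p 3 * p' 3) := by
  intro r S C ρ2 D A
  rw [fderiv_boyerLindquist, fderiv_boyerLindquist]
  set c := Real.cos (q 3) with hc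
  set s := Real.sin (q 3) with hs
  have e1 : S ^ 2 = 1 - C ^ 2 := Real.sin_sq _
  have e2 : s ^ 2 = 1 - c ^ 2 := Real.sin_sq _
  have hr' : r ≠ 0 := hr.ne'
  have hρ : ρ2 ≠ 0 := by positivity
  have hrad : rad (boyerLindquist q) = r := by
    have : (r * S * c) ^ 2 + (r * S * s) ^ 2 + (r * C) ^ 2 = r ^ 2 := by
      linear_combination r ^ 2 * S ^ 2 * e2 + r ^ 2 * e1
    change √((r * S * c) ^ 2 + (r * S * s) ^ 2 + (r * C) ^ 2) = r
    rw [this, Real.sqrt_sq hr.le]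
  have hrho : rhoSq a (boyerLindquist q) = ρ2 := by
    rw [rhoSq, hrad]
    change r ^ 2 + a ^ 2 * (r * C / r) ^ 2 = ρ2
    rw [mul_div_cancel_left₀ _ hr']
  have hdr : ∀ p, dr (boyerLindquist q) (boyerLindquistDeriv q p) = p 1 := by
    intro p
    simp only [dr, hrad, dx]
    change r⁻¹ * (r * S * c * (S * c * p 1 + r * C * c * p 2 - r * S * s * p 3)
      + r * S * s * (S * s * p 1 + r * C * s * p 2 + r * S * c * p 3)
      + r * C * (C * p 1 - r * S * p 2)) = p 1
    field_simp
    linear_combination (S ^ 2 * p 1 + S * r * C * p 2) * e2 + p 1 * e1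
  have hw : ∀ p, sinSqDphi (boyerLindquist q) (boyerLindquistDeriv q p) = S ^ 2 * p 3 := by
    intro p
    simp only [sinSqDphi, hrad, dx]
    change (r ^ 2)⁻¹ * (r * S * c * (S * s * p 1 + r * C * s * p 2 + r * S * c * p 3)
      - r * S * s * (S * c * p 1 + r * C * c * p 2 - r * S * s * p 3)) = S ^ 2 * p 3
    field_simp
    linear_combination r * S ^ 2 * p 3 * e2
  have hD : Delta M a (boyerLindquist q) = D := by rw [Delta, hrad]
  have hsum : dx 1 (boyerLindquistDeriv q p) * dx 1 (boyerLindquistDeriv q p')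
      + dx 2 (boyerLindquistDeriv q p) * dx 2 (boyerLindquistDeriv q p')
      + dx 3 (boyerLindquistDeriv q p) * dx 3 (boyerLindquistDeriv q p')
      = p 1 * p' 1 + r ^ 2 * (p 2 * p' 2) + r ^ 2 * S ^ 2 * (p 3 * p' 3) := by
    change (S * c * p 1 + r * C * c * p 2 - r * S * s * p 3)
        * (S * c * p' 1 + r * C * c * p' 2 - r * S * s * p' 3)
      + (S * s * p 1 + r * C * s * p 2 + r * S * c * p 3)
        * (S * s * p' 1 + r * C * s * p' 2 + r * S * c * p' 3)
      + (C * p 1 - r * S * p 2) * (C * p' 1 - r * S * p' 2) = _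
    linear_combination
      ((S * p 1 + r * C * p 2) * (S * p' 1 + r * C * p' 2) + r ^ 2 * S ^ 2 * (p 3 * p' 3)) * e2
        + (p 1 * p' 1 + r ^ 2 * (p 2 * p' 2)) * e1
  have h0 : ∀ p, dx 0 (boyerLindquistDeriv q p) = p 0 := fun p => rfl
  have hA : A = ρ2 * (r ^ 2 + a ^ 2) + 2 * M * r * a ^ 2 * S ^ 2 := by
    simp only [A, ρ2, D]
    linear_combination (- a ^ 2 * (r ^ 2 + a ^ 2)) * e1
  have hC : r ^ 2 + a ^ 2 = ρ2 + a ^ 2 * S ^ 2 := by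
    simp only [ρ2]; linear_combination (- a ^ 2) * e1
  have key : metric M a (boyerLindquist q) (boyerLindquistDeriv q p) (boyerLindquistDeriv q p') =
      -(1 - 2 * M * r / ρ2) * (p 0 * p' 0) + ρ2 / D * (p 1 * p' 1)
      + ρ2 / r ^ 2 * ((p 1 * p' 1 + r ^ 2 * (p 2 * p' 2) + r ^ 2 * S ^ 2 * (p 3 * p' 3))
          - p 1 * p' 1)
      - 2 * M * r * a / ρ2 * (p 0 * (S ^ 2 * p' 3) + S ^ 2 * p 3 * p' 0)
      + a ^ 2 * (1 + 2 * M * r / ρ2) * (S ^ 2 * p 3 * (S ^ 2 * p' 3)) := by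
    simp only [metric, tens, hrad, hrho, hD, ← hsum, add_apply,
      sub_apply, smul_apply,
      ContinuousLinearMap.smulRight_apply, smul_eq_mul, hdr, hw, h0]
  rw [key, hA, hC]
  have : ρ2 / r ^ 2 * ((p 1 * p' 1 + r ^ 2 * (p 2 * p' 2) + r ^ 2 * S ^ 2 * (p 3 * p' 3))
      - p 1 * p' 1) = ρ2 * (p 2 * p' 2 + S ^ 2 * (p 3 * p' 3)) := by
    field_simp
    ring
  rw [this]
  clear_value ρ2
  field_simp
  ring

/-- The domain of outer communication `K = {r > M + √(M² - a²)}`, an open subset of `ℝ⁴`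
(axis included). -/
def doc (M a : ℝ) : Set Coord := {x | M + √(M ^ 2 - a ^ 2) < rad x}

/-- The projection `(t, x₁, x₂, x₃) ↦ (x₁, x₂, x₃)`, that is, the quotient map of the action of the
flow `t ↦ t + s` of the stationary Killing field `∂ₜ`. -/
def stationaryProj (x : Coord) : Fin 3 → ℝ := ![x 1, x 2, x 3]

/-- The partial derivative `(∂_u g)(v, w)` at `x` of the metric coefficient `g(v, w)`, for constant
vectors `u, v, w` of `ℝ⁴`. -/
def metricDeriv (M a : ℝ) (x u v w : Coord) : ℝ :=
  fderiv ℝ (fun y => metric M a y v w) x u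

/-- Christoffel symbols of the first kind of the Levi-Civita connection:
`g(∇_u v, w) = ½ ((∂_u g)(v, w) + (∂_v g)(u, w) - (∂_w g)(u, v))` for constant `u, v, w`. -/
def christoffel (M a : ℝ) (x u v w : Coord) : ℝ :=
  (metricDeriv M a x u v w + metricDeriv M a x v u w - metricDeriv M a x w u v) / 2

/-- `γ` is a geodesic of the Kerr metric in the domain of outer communication on the (open) set `J`
of affine parameters: `∇_{γ'} γ' = 0`, written with the free index lowered,
`g(γ'', w) + Γ(γ', γ'; w) = 0` for all `w`. -/
def IsGeodesicOn (M a : ℝ) (γ : ℝ → Coord) (J : Set ℝ) : Prop :=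
  ∀ s ∈ J, γ s ∈ doc M a ∧ DifferentiableAt ℝ γ s ∧ DifferentiableAt ℝ (deriv γ) s ∧
    ∀ w : Coord, metric M a (γ s) (deriv (deriv γ) s) w
      + christoffel M a (γ s) (deriv γ s) (deriv γ s) w = 0

/-- The geodesic of `K` with initial data `γ(0) = x`, `γ'(0) = p` is trapped: its whole orbit,
projected to the quotient of `K` by the action of `∂ₜ`, is contained in a compact subset of that
quotient. The orbit of the inextendible geodesic is the union of the orbits of all geodesics with
these initial data that are defined on an open interval around `0`. -/
def IsTrapped (M a : ℝ) (x p : Coord) : Prop :=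
  ∃ C : Set (Fin 3 → ℝ), IsCompact C ∧ C ⊆ stationaryProj '' doc M a ∧
    ∀ (γ : ℝ → Coord) (J : Set ℝ), IsOpen J → J.OrdConnected → (0 : ℝ) ∈ J →
      IsGeodesicOn M a γ J → γ 0 = x → deriv γ 0 = p → ∀ s ∈ J, stationaryProj (γ s) ∈ C

/-- The tangent bundle `TK = K × ℝ⁴` of the open set `K ⊆ ℝ⁴`. -/
def tangentBundle (M a : ℝ) : Set (Coord × Coord) := {z | z.1 ∈ doc M a}

/-- The cotangent bundle `T*K = K × (ℝ⁴)*` of the open set `K ⊆ ℝ⁴`. -/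
def cotangentBundle (M a : ℝ) : Set (Coord × (Coord →L[ℝ] ℝ)) := {z | z.1 ∈ doc M a}

/-- The canonical isomorphism `TK → T*K`, `(x, p) ↦ (x, g_x(p, ·))`. -/
def flat (M a : ℝ) (z : Coord × Coord) : Coord × (Coord →L[ℝ] ℝ) := (z.1, metric M a z.1 z.2)

/-- The photon region `P' ⊆ TK`: the pairs `(x, p)` with `x ∈ K`, `p` null and future-directed, such
that the geodesic with these initial data is trapped. Since `dt` is timelike on `K`, a nonzero null
vector `p` is future-directed exactly if `p⁰ = dt(p) > 0`. -/
def photonRegion (M a : ℝ) : Set (Coord × Coord) :=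
  {z | z ∈ tangentBundle M a ∧ metric M a z.1 z.2 z.2 = 0 ∧ 0 < z.2 0 ∧ IsTrapped M a z.1 z.2}

/-- The photon region `P ⊆ T*K`, the image of `P'` under the canonical isomorphism. -/
def cotangentPhotonRegion (M a : ℝ) : Set (Coord × (Coord →L[ℝ] ℝ)) :=
  flat M a '' photonRegion M a

/-- `S` is a smooth embedded submanifold of dimension `k` of the open subset `U` of the vector space
`E`: around each of its points there is a smooth chart of `U` in which `S` is a `k`-dimensional
linear slice. -/
def IsSmoothSubmanifold {E : Type*} [NormedAddCommGroup E] [NormedSpace ℝ E]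
    (k : ℕ) (U S : Set E) : Prop :=
  S ⊆ U ∧ ∀ z ∈ S, ∃ (e : OpenPartialHomeomorph E E) (W : Submodule ℝ E),
    z ∈ e.source ∧ e.source ⊆ U ∧ ContDiffOn ℝ ∞ e e.source ∧ ContDiffOn ℝ ∞ e.symm e.target ∧
    Module.finrank ℝ W = k ∧ e '' (S ∩ e.source) = e.target ∩ (W : Set E)

end Kerr

end

open scoped ContDiff NNReal Manifold
set_option maxSynthPendingDepth 3

noncomputable section

namespace Kerr

open Set Filter Topology

variable {M a : ℝ}

/-! Why the theorem holds. Along a null geodesic the energy `E`, the angular momentum `L` and the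
Carter constant `K` are conserved. The radius satisfies `(ρ² r')² = R(r)` with `R = X² - K Δ` and `X
= (r² + a²) E - a L`. Moreover `X = Δ τ(γ')` with `τ = dt - a sin² ϑ dφ`. A null vector with `τ = 0`
vanishes, so `X` has no zero along a photon.

A trapped photon is complete: `E` and `L` bound its velocity over the compact set, so modulo time
translation it stays in a compact part of `TK`. Its radius is then a bounded solution of the radial
equation on all of `ℝ`, and `R` vanishes at its supremum and its infimum. If these differed, `Φ =
X²/Δ` would be at least `K` between them and equal to `K` at both ends, so it would have an interior
maximum over the interval. But subcriticality makes the value of `Φ` at a critical point with `X ≠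
0` strictly smaller than at every larger radius (`lt_of_criticalFn_eq_zero`). Hence `r` is constant
(`eq_of_radial_bounded`), and the radial equation reduces to `criticalFn = 0`. Conversely, `r' = 0`
and `criticalFn = 0` at one instant make the initial radius a double zero of `R`, and a Gronwall
estimate keeps the geodesic on its sphere.

So `P'` is cut out of the open set `dt(p) > 0` by three equations: `g(p, p) = 0`, `dr(p) = 0`,
`criticalFn = 0` (`photonRegion_eq`). Their differentials are independent
(`surjective_fderiv_photonFn`), mainly because the radial derivative of `criticalFn` is nonzero at
its zeros. This leaves dimension `8 - 3 = 5`. The result for `P` follows because `flat` is a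
diffeomorphism. -/

lemma dx_apply (i : Fin 4) (v : Coord) : dx i v = v i := rfl

/-! ### Pointwise algebra of the Kerr metric -/

/-- The spatial inner product `v₁w₁ + v₂w₂ + v₃w₃`. -/
def spatialDot (v w : Coord) : ℝ := v 1 * w 1 + v 2 * w 2 + v 3 * w 3

/-- The one-form `dt - a sin² ϑ dφ`. -/
def tau (a : ℝ) (x : Coord) : Coord →L[ℝ] ℝ := dx 0 - a • sinSqDphi x

/-- The function `2Mr/ρ²`. -/
def massFn (M a : ℝ) (x : Coord) : ℝ := 2 * M * rad x / rhoSq a x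

/-- The stationary Killing field `∂ₜ`. -/
def stat : Coord := ![1, 0, 0, 0]

/-- The axial Killing field `∂_φ`. -/
def axial : Coord →L[ℝ] Coord := ContinuousLinearMap.pi ![0, -dx 2, dx 1, 0]

/-- The spatial Euler field `r ∂_r`. -/
def euler : Coord →L[ℝ] Coord := ContinuousLinearMap.pi ![0, dx 1, dx 2, dx 3]

@[simp] lemma stat_zero : stat 0 = 1 := rfl
@[simp] lemma stat_one : stat 1 = 0 := rfl
@[simp] lemma stat_two : stat 2 = 0 := rfl
@[simp] lemma stat_three : stat 3 = 0 := rfl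
@[simp] lemma axial_zero (x : Coord) : axial x 0 = 0 := rfl
@[simp] lemma axial_one (x : Coord) : axial x 1 = -x 2 := rfl
@[simp] lemma axial_two (x : Coord) : axial x 2 = x 1 := rfl
@[simp] lemma axial_three (x : Coord) : axial x 3 = 0 := rfl
@[simp] lemma euler_zero (x : Coord) : euler x 0 = 0 := rfl
@[simp] lemma euler_one (x : Coord) : euler x 1 = x 1 := rfl
@[simp] lemma euler_two (x : Coord) : euler x 2 = x 2 := rfl
@[simp] lemma euler_three (x : Coord) : euler x 3 = x 3 := rfl

lemma dr_apply (x v : Coord) : dr x v = (rad x)⁻¹ * spatialDot x v := by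
  simp [dr, dx_apply, spatialDot]; ring

lemma sinSqDphi_apply (x v : Coord) :
    sinSqDphi x v = (rad x ^ 2)⁻¹ * (x 1 * v 2 - x 2 * v 1) := by
  simp [sinSqDphi, dx_apply]

lemma tau_apply (x v : Coord) : tau a x v = v 0 - a * sinSqDphi x v := by
  simp [tau, dx_apply]

/-- Completing the square: with `ω = sin² ϑ dφ`, all terms containing `2Mr/ρ²` combine into the
single square `(2Mr/ρ²) (dt - a ω)²`, and `-dt² + a² ω²` remains. -/
lemma metric_apply (x v w : Coord) :
    metric M a x v w = -(v 0 * w 0) + massFn M a x * (tau a x v * tau a x w)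
      + a ^ 2 * (sinSqDphi x v * sinSqDphi x w)
      + rhoSq a x / rad x ^ 2 * (spatialDot v w - dr x v * dr x w)
      + rhoSq a x / Delta M a x * (dr x v * dr x w) := by
  simp only [metric, tens, tau_apply, massFn, spatialDot, add_apply, sub_apply, smul_apply,
    ContinuousLinearMap.smulRight_apply, smul_eq_mul, dx_apply]
  ring

lemma metric_symm (x v w : Coord) : metric M a x v w = metric M a x w v := by
  simp only [metric_apply, spatialDot]; ring

lemma rad_sq (x : Coord) : rad x ^ 2 = spatialDot x x := by
  rw [rad, Real.sq_sqrt (by positivity)]; simp only [spatialDot]; ring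

lemma mass_pos (h : |a| < M) : 0 < M := (abs_nonneg a).trans_lt h

lemma sq_lt_mass_sq (h : |a| < M) : a ^ 2 < M ^ 2 :=
  sq_lt_sq.2 (h.trans_le (le_abs_self M))

lemma lt_rad (x : Coord) (hx : x ∈ doc M a) : M < rad x :=
  lt_of_le_of_lt (le_add_of_nonneg_right (Real.sqrt_nonneg _)) hx

lemma rad_pos (h : |a| < M) {x : Coord} (hx : x ∈ doc M a) : 0 < rad x :=
  (mass_pos h).trans (lt_rad x hx)

/-- `r² - 2Mr + a²` is positive beyond the horizon. -/
lemma horizon_pos (h : |a| < M) {r : ℝ} (hr : M + √(M ^ 2 - a ^ 2) < r) :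
    0 < r ^ 2 - 2 * M * r + a ^ 2 := by
  have h0 := sq_lt_mass_sq h
  have h1 : √(M ^ 2 - a ^ 2) ^ 2 = M ^ 2 - a ^ 2 := Real.sq_sqrt (by linarith)
  have h2 := Real.sqrt_nonneg (M ^ 2 - a ^ 2)
  nlinarith

lemma Delta_pos (h : |a| < M) {x : Coord} (hx : x ∈ doc M a) : 0 < Delta M a x :=
  horizon_pos h hx

lemma rad_sq_le_rhoSq (x : Coord) : rad x ^ 2 ≤ rhoSq a x :=
  le_add_of_nonneg_right (by positivity)

lemma rhoSq_pos (h : |a| < M) {x : Coord} (hx : x ∈ doc M a) : 0 < rhoSq a x :=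
  (pow_pos (rad_pos h hx) 2).trans_le (rad_sq_le_rhoSq x)

lemma massFn_pos (h : |a| < M) {x : Coord} (hx : x ∈ doc M a) : 0 < massFn M a x := by
  have := mass_pos h
  have := rad_pos h hx
  have := rhoSq_pos h hx
  unfold massFn; positivity

lemma cosSq_le_one {x : Coord} (hr : 0 < rad x) : (x 3 / rad x) ^ 2 ≤ 1 := by
  rw [div_pow, div_le_one (by positivity), rad_sq, spatialDot]
  nlinarith [sq_nonneg (x 1), sq_nonneg (x 2)]

lemma rhoSq_le {x : Coord} (hr : 0 < rad x) : rhoSq a x ≤ rad x ^ 2 + a ^ 2 := by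
  unfold rhoSq
  nlinarith [cosSq_le_one hr, sq_nonneg a]

/-- The Cauchy-Schwarz inequality: the angular part of the Euclidean metric is nonnegative. -/
lemma dr_sq_le {x : Coord} (hr : 0 < rad x) (v : Coord) : dr x v ^ 2 ≤ spatialDot v v := by
  rw [dr_apply, mul_pow, inv_pow, inv_mul_le_iff₀ (by positivity), rad_sq]
  simp only [spatialDot]
  nlinarith [sq_nonneg (x 1 * v 2 - x 2 * v 1), sq_nonneg (x 1 * v 3 - x 3 * v 1),
    sq_nonneg (x 2 * v 3 - x 3 * v 2)]

/-- The energy `E = -g(∂ₜ, v)`. -/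
def energy (M a : ℝ) (x v : Coord) : ℝ := -metric M a x v stat

/-- The angular momentum `L = g(∂_φ, v)`. -/
def angMom (M a : ℝ) (x v : Coord) : ℝ := metric M a x v (axial x)

lemma energy_eq (x v : Coord) : energy M a x v = v 0 - massFn M a x * tau a x v := by
  simp [energy, metric_apply, tau_apply, sinSqDphi_apply, dr_apply, spatialDot]; ring

lemma dr_axial (x : Coord) : dr x (axial x) = 0 := by
  simp [dr_apply, spatialDot]; right; ring

lemma sinSqDphi_axial {x : Coord} (hr : 0 < rad x) :
    sinSqDphi x (axial x) = 1 - (x 3 / rad x) ^ 2 := by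
  have h := rad_sq x
  simp only [spatialDot] at h
  rw [sinSqDphi_apply]
  simp only [axial_two, axial_one]
  field_simp
  linear_combination -h

lemma spatialDot_axial {x : Coord} (hr : 0 < rad x) (v : Coord) :
    spatialDot v (axial x) = rad x ^ 2 * sinSqDphi x v := by
  rw [sinSqDphi_apply, spatialDot]
  simp only [axial_one, axial_two, axial_three]
  field_simp
  ring

lemma angMom_eq (h : |a| < M) {x : Coord} (hx : x ∈ doc M a) (v : Coord) :
    angMom M a x v = (1 - (x 3 / rad x) ^ 2) * (a ^ 2 * sinSqDphi x v
      - a * massFn M a x * tau a x v) + rhoSq a x * sinSqDphi x v := by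
  have hr := rad_pos h hx
  rw [angMom, metric_apply, dr_axial, spatialDot_axial hr, tau_apply x (axial x),
    sinSqDphi_axial hr, axial_zero]
  field_simp
  ring

/-- The momentum `(r² + a²) E - a L` along the principal null directions. -/
lemma principal_eq (h : |a| < M) {x : Coord} (hx : x ∈ doc M a) (v : Coord) :
    (rad x ^ 2 + a ^ 2) * energy M a x v - a * angMom M a x v = Delta M a x * tau a x v := by
  have hr := rad_pos h hx
  have hρ := (rhoSq_pos h hx).ne'
  have hm : massFn M a x * rhoSq a x = 2 * M * rad x := by unfold massFn; field_simp
  rw [energy_eq, angMom_eq h hx]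
  have h1 : v 0 = tau a x v + a * sinSqDphi x v := by rw [tau_apply]; ring
  rw [h1, Delta]
  have h2 : a ^ 2 * (x 3 / rad x) ^ 2 = rhoSq a x - rad x ^ 2 := by rw [rhoSq]; ring
  linear_combination (-(massFn M a x * tau a x v) + a * sinSqDphi x v) * h2 - tau a x v * hm

lemma spatialDot_euler (x v : Coord) : spatialDot v (euler x) = spatialDot x v := by
  simp only [spatialDot, euler_one, euler_two, euler_three]; ring

lemma dr_euler {x : Coord} (hr : 0 < rad x) : dr x (euler x) = rad x := by
  rw [dr_apply, spatialDot_euler, ← rad_sq]; field_simp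

/-- Since `r ∂_r` is orthogonal to the spheres `r = const` and to `∂ₜ`, pairing with it sees only
the radial velocity. This lets the radial equation be derived from a Lie derivative along the Euler
field. -/
lemma metric_euler (h : |a| < M) {x : Coord} (hx : x ∈ doc M a) (v : Coord) :
    metric M a x v (euler x) = rad x * (rhoSq a x / Delta M a x) * dr x v := by
  have hr := rad_pos h hx
  have hs : sinSqDphi x (euler x) = 0 := by rw [sinSqDphi_apply]; simp; right; ring
  have hd : spatialDot x v = rad x * dr x v := by rw [dr_apply]; field_simp
  rw [metric_apply, spatialDot_euler, dr_euler hr, tau_apply x (euler x), hs, euler_zero, hd]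
  ring

/-- The nullity condition with all other terms on the right. -/
lemma null_iff (x v : Coord) :
    metric M a x v v = 0 ↔ rhoSq a x / rad x ^ 2 * (spatialDot v v - dr x v ^ 2)
      + rhoSq a x / Delta M a x * dr x v ^ 2
      = v 0 ^ 2 - massFn M a x * tau a x v ^ 2 - a ^ 2 * sinSqDphi x v ^ 2 := by
  rw [metric_apply]
  constructor <;> intro h <;> linear_combination h

lemma eq_zero_of_spatialDot {v : Coord} (h0 : v 0 = 0) (h : spatialDot v v = 0) : v = 0 := by
  rw [spatialDot] at h
  have h1 : v 1 = 0 := by nlinarith [sq_nonneg (v 1), sq_nonneg (v 2), sq_nonneg (v 3)]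
  have h2 : v 2 = 0 := by nlinarith [sq_nonneg (v 1), sq_nonneg (v 2), sq_nonneg (v 3)]
  have h3 : v 3 = 0 := by nlinarith [sq_nonneg (v 1), sq_nonneg (v 2), sq_nonneg (v 3)]
  ext i
  fin_cases i
  exacts [h0, h1, h2, h3]

/-- A null vector orthogonal to the timelike principal direction vanishes. -/
lemma eq_zero_of_null_of_tau (h : |a| < M) {x : Coord} (hx : x ∈ doc M a) {v : Coord}
    (hn : metric M a x v v = 0) (ht : tau a x v = 0) : v = 0 := by
  have hr := rad_pos h hx
  have hρ := rhoSq_pos h hx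
  have hD := Delta_pos h hx
  -- `τ(v) = 0` makes the right side of `null_iff` cancel, so a sum of nonnegative terms is zero.
  have h0 : v 0 = a * sinSqDphi x v := by rw [tau_apply] at ht; linarith
  rw [null_iff, ht, h0] at hn
  have hcs := sub_nonneg.2 (dr_sq_le hr v)
  have e : rhoSq a x / rad x ^ 2 * (spatialDot v v - dr x v ^ 2)
      + rhoSq a x / Delta M a x * dr x v ^ 2 = 0 := by rw [hn]; ring
  have e1 : 0 ≤ rhoSq a x / rad x ^ 2 * (spatialDot v v - dr x v ^ 2) := by positivity
  have e2 : 0 ≤ rhoSq a x / Delta M a x * dr x v ^ 2 := by positivity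
  have f1 : rhoSq a x / rad x ^ 2 * (spatialDot v v - dr x v ^ 2) = 0 := by linarith
  have f2 : rhoSq a x / Delta M a x * dr x v ^ 2 = 0 := by linarith
  have g1 : spatialDot v v - dr x v ^ 2 = 0 :=
    (mul_eq_zero.1 f1).resolve_left (by positivity)
  have g2 : dr x v ^ 2 = 0 := (mul_eq_zero.1 f2).resolve_left (by positivity)
  have hs : spatialDot v v = 0 := by linarith
  have hω : v 1 = 0 ∧ v 2 = 0 := by
    rw [spatialDot] at hs
    constructor <;> nlinarith [sq_nonneg (v 1), sq_nonneg (v 2), sq_nonneg (v 3)]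
  refine eq_zero_of_spatialDot ?_ hs
  rw [h0, sinSqDphi_apply, hω.1, hω.2]; simp

/-! ### Nondegeneracy and smoothness of the metric -/

/-- A vector in the kernel is null and has `E = L = 0`. Then `Δ τ = 0` by `principal_eq`, and a null
vector with `τ = 0` vanishes. -/
lemma metric_injective (h : |a| < M) {x : Coord} (hx : x ∈ doc M a) :
    Function.Injective (metric M a x) := by
  refine (injective_iff_map_eq_zero _).2 fun v hv => ?_
  have hw : ∀ w, metric M a x v w = 0 := fun w => by rw [hv]; rfl
  refine eq_zero_of_null_of_tau h hx (hw v) ?_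
  have := principal_eq h hx v
  rw [energy, angMom, hw, hw] at this
  have hD := (Delta_pos h hx).ne'
  simpa [hD] using this

lemma metric_isInvertible (h : |a| < M) {x : Coord} (hx : x ∈ doc M a) :
    (metric M a x).IsInvertible := by
  have hfin : Module.finrank ℝ Coord = Module.finrank ℝ (Coord →L[ℝ] ℝ) := by
    rw [← LinearEquiv.finrank_eq (LinearMap.toContinuousLinearMap (𝕜 := ℝ) (E := Coord) (F' := ℝ))]
    exact (Subspace.dual_finrank_eq (K := ℝ) (V := Coord)).symm
  refine ⟨(LinearEquiv.ofInjectiveOfFinrankEq (metric M a x).toLinearMap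
    (metric_injective h hx) hfin).toContinuousLinearEquiv, ?_⟩
  ext v w
  rfl

lemma contDiffAt_rad {x : Coord} (hr : 0 < rad x) : ContDiffAt ℝ ∞ rad x := by
  have : x 1 ^ 2 + x 2 ^ 2 + x 3 ^ 2 ≠ 0 := (Real.sqrt_pos.1 hr).ne'
  unfold rad
  exact ContDiffAt.sqrt (by fun_prop) this

lemma continuous_rad : Continuous rad := by unfold rad; fun_prop

lemma isOpen_doc : IsOpen (doc M a) := isOpen_lt continuous_const continuous_rad

lemma contDiffAt_rhoSq {x : Coord} (hr : 0 < rad x) : ContDiffAt ℝ ∞ (rhoSq a) x := by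
  have := contDiffAt_rad hr
  have h3 : ContDiffAt ℝ ∞ (fun x : Coord => x 3) x := by fun_prop
  unfold rhoSq
  exact (this.pow 2).add (contDiffAt_const.mul ((h3.div this hr.ne').pow 2))

lemma contDiffAt_Delta {x : Coord} (hr : 0 < rad x) : ContDiffAt ℝ ∞ (Delta M a) x := by
  have := contDiffAt_rad hr
  unfold Delta
  exact ((this.pow 2).sub (contDiffAt_const.mul this)).add contDiffAt_const

lemma contDiffAt_dr {x : Coord} (hr : 0 < rad x) : ContDiffAt ℝ ∞ dr x := by
  have := contDiffAt_rad hr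
  unfold dr
  exact (this.inv hr.ne').smul (by fun_prop)

lemma contDiffAt_sinSqDphi {x : Coord} (hr : 0 < rad x) : ContDiffAt ℝ ∞ sinSqDphi x := by
  have := contDiffAt_rad hr
  unfold sinSqDphi
  exact ((this.pow 2).inv (pow_pos hr 2).ne').smul (by fun_prop)

lemma contDiffAt_tens {α β : Coord → Coord →L[ℝ] ℝ} {x : Coord} (hα : ContDiffAt ℝ ∞ α x)
    (hβ : ContDiffAt ℝ ∞ β x) : ContDiffAt ℝ ∞ (fun y => tens (α y) (β y)) x := by
  unfold tens
  exact hα.smulRight hβ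

lemma contDiffAt_metric (h : |a| < M) {x : Coord} (hx : x ∈ doc M a) :
    ContDiffAt ℝ ∞ (metric M a) x := by
  have hr := rad_pos h hx
  have hρ := (rhoSq_pos h hx).ne'
  have hD := (Delta_pos h hx).ne'
  have c1 := contDiffAt_rad hr
  have c2 := contDiffAt_rhoSq (a := a) hr
  have c3 := contDiffAt_Delta (M := M) (a := a) hr
  have c4 := contDiffAt_dr hr
  have c5 := contDiffAt_sinSqDphi hr
  have hd : ∀ i, ContDiffAt ℝ ∞ (fun _ : Coord => dx i) x := fun i => contDiffAt_const
  have c6 := contDiffAt_tens c4 c4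
  have c7 := contDiffAt_tens c5 c5
  have c8 := contDiffAt_tens (hd 0) c5
  have c9 := contDiffAt_tens c5 (hd 0)
  have cm : ContDiffAt ℝ ∞ (fun y => 2 * M * rad y / rhoSq a y) x :=
    (contDiffAt_const.mul c1).div c2 hρ
  have cm' : ContDiffAt ℝ ∞ (fun y => 2 * M * rad y * a / rhoSq a y) x :=
    ((contDiffAt_const.mul c1).mul contDiffAt_const).div c2 hρ
  unfold metric
  refine ContDiffAt.add (ContDiffAt.sub (ContDiffAt.add (ContDiffAt.add ?_ ?_) ?_) ?_) ?_
  · exact (contDiffAt_const.sub cm).neg.smul contDiffAt_const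
  · exact (c2.div c3 hD).smul c6
  · exact (c2.div (c1.pow 2) (pow_pos hr 2).ne').smul (contDiffAt_const.sub c6)
  · exact cm'.smul (c8.add c9)
  · exact (contDiffAt_const.mul (contDiffAt_const.add cm)).smul c7

lemma differentiableAt_metric (h : |a| < M) {x : Coord} (hx : x ∈ doc M a) :
    DifferentiableAt ℝ (metric M a) x :=
  (contDiffAt_metric h hx).differentiableAt (by simp)

/-! ### Derivatives of the metric along the Killing fields and the Euler field -/

lemma metricDeriv_eq (h : |a| < M) {x : Coord} (hx : x ∈ doc M a) (u v w : Coord) :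
    metricDeriv M a x u v w = fderiv ℝ (metric M a) x u v w := by
  have := ((differentiableAt_metric h hx).hasFDerivAt.clm_apply
    (hasFDerivAt_const v x)).clm_apply (hasFDerivAt_const w x)
  rw [metricDeriv, this.fderiv]
  simp

/-- The derivative of `g(V, U)` along a curve. -/
lemma hasDerivAt_metric (h : |a| < M) {c V U : ℝ → Coord} {c' V' U' : Coord} {s : ℝ}
    (hx : c s ∈ doc M a) (hc : HasDerivAt c c' s) (hV : HasDerivAt V V' s)
    (hU : HasDerivAt U U' s) :
    HasDerivAt (fun s => metric M a (c s) (V s) (U s))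
      (metricDeriv M a (c s) c' (V s) (U s) + metric M a (c s) V' (U s)
        + metric M a (c s) (V s) U') s := by
  have h1 := (differentiableAt_metric h hx).hasFDerivAt.comp_hasDerivAt s hc
  have h2 := (h1.clm_apply hV).clm_apply hU
  rw [metricDeriv_eq h hx]
  exact h2

lemma hasDerivAt_line (x w : Coord) : HasDerivAt (fun l : ℝ => x + l • w) w 0 := by
  simpa using ((hasDerivAt_id (0 : ℝ)).smul_const w).const_add x

/-- The metric is stationary. -/
lemma metricDeriv_stat (h : |a| < M) {x : Coord} (hx : x ∈ doc M a) (v w : Coord) :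
    metricDeriv M a x stat v w = 0 := by
  have h0 : x + (0 : ℝ) • stat = x := by simp
  have h1 := hasDerivAt_metric (M := M) (a := a) h (by rwa [h0]) (hasDerivAt_line x stat)
    (hasDerivAt_const 0 v) (hasDerivAt_const 0 w)
  have h2 : ∀ l : ℝ, metric M a (x + l • stat) = metric M a x := fun l => by
    simp [metric, dr, sinSqDphi, rhoSq, Delta, rad]
  simp only [h2] at h1
  simpa using h1.unique (hasDerivAt_const (0 : ℝ) (metric M a x v w))

/-- The rotation by the angle `l` about the axis. -/
def rotation (l : ℝ) (x : Coord) : Coord :=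
  ![x 0, Real.cos l * x 1 - Real.sin l * x 2, Real.sin l * x 1 + Real.cos l * x 2, x 3]

lemma hasDerivAt_rotation (x : Coord) : HasDerivAt (fun l => rotation l x) (axial x) 0 := by
  have hc := Real.hasDerivAt_cos 0
  have hs := Real.hasDerivAt_sin 0
  rw [hasDerivAt_pi]
  intro i
  fin_cases i
  · exact hasDerivAt_const 0 (x 0)
  · exact ((hc.mul_const (x 1)).sub (hs.mul_const (x 2))).congr_deriv (by simp)
  · exact ((hs.mul_const (x 1)).add (hc.mul_const (x 2))).congr_deriv (by simp)
  · exact hasDerivAt_const 0 (x 3)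

lemma spatialDot_rotation (l : ℝ) (v w : Coord) :
    spatialDot (rotation l v) (rotation l w) = spatialDot v w := by
  simp only [spatialDot, rotation, Matrix.cons_val]
  linear_combination (v 1 * w 1 + v 2 * w 2) * Real.cos_sq_add_sin_sq l

lemma rad_eq_sqrt (x : Coord) : rad x = √(spatialDot x x) := by
  simp only [rad, spatialDot, pow_two]

lemma metric_rotation (l : ℝ) (x v w : Coord) :
    metric M a (rotation l x) (rotation l v) (rotation l w) = metric M a x v w := by
  have h1 : rad (rotation l x) = rad x := by rw [rad_eq_sqrt, spatialDot_rotation, ← rad_eq_sqrt]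
  have h2 : ∀ v, dr (rotation l x) (rotation l v) = dr x v := fun v => by
    rw [dr_apply, dr_apply, h1, spatialDot_rotation]
  have h3 : ∀ v, sinSqDphi (rotation l x) (rotation l v) = sinSqDphi x v := fun v => by
    rw [sinSqDphi_apply, sinSqDphi_apply, h1]
    congr 1
    simp only [rotation, Matrix.cons_val]
    linear_combination (x 1 * v 2 - x 2 * v 1) * Real.cos_sq_add_sin_sq l
  have h4 : ∀ v, rotation l v 0 = v 0 := fun v => rfl
  have h5 : rotation l x 3 = x 3 := rfl
  simp only [metric_apply, massFn, tau_apply, rhoSq, Delta, h1, h2, h3, h4, h5,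
    spatialDot_rotation]

/-- The metric is axisymmetric. -/
lemma metricDeriv_axial (h : |a| < M) {x : Coord} (hx : x ∈ doc M a) (v w : Coord) :
    metricDeriv M a x (axial x) v w + metric M a x (axial v) w + metric M a x v (axial w) = 0 := by
  have h0 : ∀ x, rotation 0 x = x := fun x => by ext i; fin_cases i <;> simp [rotation]
  have h1 := hasDerivAt_metric (M := M) (a := a) h (by rwa [h0]) (hasDerivAt_rotation x)
    (hasDerivAt_rotation v) (hasDerivAt_rotation w)
  simp only [metric_rotation, h0] at h1
  exact h1.unique (hasDerivAt_const (0 : ℝ) (metric M a x v w))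

/-- Spatial dilation by `1 + l` multiplies `r` and `dr` by `1 + l` and fixes `dt`, `sin² ϑ dφ` and
`cos ϑ`. The pulled-back metric is thus explicit in `l`, and its derivative at `l = 0` is the Lie
derivative along the Euler field. The bound on `l` keeps the factor positive. -/
lemma metric_scale (h : |a| < M) {x : Coord} (hx : x ∈ doc M a) (v : Coord) {l : ℝ}
    (hl : -1 < l) :
    metric M a (x + l • euler x) (v + l • euler v) (v + l • euler v) = -v 0 ^ 2
      + 2 * M * ((1 + l) * rad x) / ((1 + l) ^ 2 * rad x ^ 2 + a ^ 2 * (x 3 / rad x) ^ 2)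
        * tau a x v ^ 2 + a ^ 2 * sinSqDphi x v ^ 2
      + ((1 + l) ^ 2 * rad x ^ 2 + a ^ 2 * (x 3 / rad x) ^ 2) / rad x ^ 2
        * (spatialDot v v - dr x v ^ 2)
      + ((1 + l) ^ 2 * rad x ^ 2 + a ^ 2 * (x 3 / rad x) ^ 2)
        / ((1 + l) ^ 2 * rad x ^ 2 - 2 * M * ((1 + l) * rad x) + a ^ 2)
        * ((1 + l) ^ 2 * dr x v ^ 2) := by
  have hr := rad_pos h hx
  have hl' : 0 < 1 + l := by linarith
  have hdot : ∀ v w : Coord, spatialDot (v + l • euler v) (w + l • euler w)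
      = (1 + l) ^ 2 * spatialDot v w := fun v w => by simp [spatialDot]; ring
  have h1 : rad (x + l • euler x) = (1 + l) * rad x := by
    rw [rad_eq_sqrt, hdot, Real.sqrt_mul (by positivity), Real.sqrt_sq hl'.le, ← rad_eq_sqrt]
  have h2 : dr (x + l • euler x) (v + l • euler v) = (1 + l) * dr x v := by
    rw [dr_apply, dr_apply, h1, hdot]; field_simp
  have h3 : sinSqDphi (x + l • euler x) (v + l • euler v) = sinSqDphi x v := by
    rw [sinSqDphi_apply, sinSqDphi_apply, h1]
    simp
    field_simp
  have h4 : (v + l • euler v) 0 = v 0 := by simp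
  have h5 : (x + l • euler x) 3 = (1 + l) * x 3 := by simp; ring
  have h6 : (1 + l) * x 3 / ((1 + l) * rad x) = x 3 / rad x := by field_simp
  simp only [metric_apply, massFn, tau_apply, rhoSq, Delta, h1, h2, h3, h4, h5, h6, hdot]
  field_simp

/-- The Lie derivative of the metric along the spatial Euler field. -/
lemma metricDeriv_euler (h : |a| < M) {x : Coord} (hx : x ∈ doc M a) (v : Coord) :
    metricDeriv M a x (euler x) v v + 2 * metric M a x v (euler v) =
      massFn M a x * (1 - 2 * rad x ^ 2 / rhoSq a x) * tau a x v ^ 2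
      + 2 * (spatialDot v v - dr x v ^ 2)
      + (2 * rad x ^ 2 / Delta M a x + 2 * rhoSq a x / Delta M a x
        - rhoSq a x * (2 * rad x ^ 2 - 2 * M * rad x) / Delta M a x ^ 2) * dr x v ^ 2 := by
  have hr := rad_pos h hx
  have hρ := (rhoSq_pos h hx).ne'
  have hD := (Delta_pos h hx).ne'
  have h0 : ∀ x : Coord, x + (0 : ℝ) • euler x = x := by simp
  have h1 := hasDerivAt_metric (M := M) (a := a) h (by rwa [h0]) (hasDerivAt_line x (euler x))
    (hasDerivAt_line v (euler v)) (hasDerivAt_line v (euler v))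
  simp only [h0] at h1
  have hl : HasDerivAt (fun l : ℝ => 1 + l) 1 0 := (hasDerivAt_id (0 : ℝ)).const_add 1
  have hl2 : HasDerivAt (fun l : ℝ => (1 + l) ^ 2) 2 0 :=
    (hl.pow 2).congr_deriv (by norm_num)
  have hρl : HasDerivAt (fun l : ℝ => (1 + l) ^ 2 * rad x ^ 2 + a ^ 2 * (x 3 / rad x) ^ 2)
      (2 * rad x ^ 2) 0 := (hl2.mul_const _).add_const _
  have hrl : HasDerivAt (fun l : ℝ => 2 * M * ((1 + l) * rad x)) (2 * M * (1 * rad x)) 0 :=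
    (hl.mul_const _).const_mul _
  have hDl : HasDerivAt (fun l : ℝ => (1 + l) ^ 2 * rad x ^ 2 - 2 * M * ((1 + l) * rad x) + a ^ 2)
      (2 * rad x ^ 2 - 2 * M * (1 * rad x)) 0 := ((hl2.mul_const _).sub hrl).add_const _
  have eρ : (1 + (0 : ℝ)) ^ 2 * rad x ^ 2 + a ^ 2 * (x 3 / rad x) ^ 2 = rhoSq a x := by
    rw [rhoSq]; ring
  have eD : (1 + (0 : ℝ)) ^ 2 * rad x ^ 2 - 2 * M * ((1 + 0) * rad x) + a ^ 2 = Delta M a x := by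
    rw [Delta]; ring
  have h2 := ((((hrl.div hρl (by rwa [eρ])).mul_const (tau a x v ^ 2)).const_add
    (-v 0 ^ 2)).add_const (a ^ 2 * sinSqDphi x v ^ 2)).add
      ((hρl.div_const (rad x ^ 2)).mul_const (spatialDot v v - dr x v ^ 2)) |>.add
      ((hρl.div hDl (by rwa [eD])).mul (hl2.mul_const (dr x v ^ 2)))
  have h3 := HasDerivAt.congr_of_eventuallyEq (f₁ := fun l : ℝ =>
    metric M a (x + l • euler x) (v + l • euler v) (v + l • euler v)) h2 (by
      filter_upwards [lt_mem_nhds (show (-1 : ℝ) < 0 by norm_num)] with l hl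
      exact metric_scale h hx v hl)
  have h4 := h1.unique h3
  rw [metric_symm x (euler v) v] at h4
  simp only [Pi.div_apply] at h4
  rw [eρ, eD] at h4
  rw [massFn]
  refine Eq.trans (by ring) (h4.trans ?_)
  field_simp
  ring

lemma eq_of_hasDerivAt_zero {f : ℝ → ℝ} {J : Set ℝ} (hJ : IsOpen J) (hc : J.OrdConnected)
    (hf : ∀ s ∈ J, HasDerivAt f 0 s) {s t : ℝ} (hs : s ∈ J) (ht : t ∈ J) : f s = f t :=
  hJ.is_const_of_deriv_eq_zero hc.isPreconnected
    (fun s hs => (hf s hs).differentiableAt.differentiableWithinAt)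
    (fun s hs => (hf s hs).deriv) hs ht

lemma hasFDerivAt_rad {x : Coord} (hr : 0 < rad x) : HasFDerivAt rad (dr x) x := by
  have h0 : x 1 ^ 2 + x 2 ^ 2 + x 3 ^ 2 ≠ 0 := (Real.sqrt_pos.1 hr).ne'
  have h : ∀ i : Fin 4, HasFDerivAt (fun q : Coord => q i) (dx i) x :=
    fun i => hasFDerivAt_apply i x
  refine (((((h 1).pow 2).add ((h 2).pow 2)).add ((h 3).pow 2)).sqrt h0).congr_fderiv ?_
  ext v
  simp only [dr, add_apply, smul_apply, smul_eq_mul, Pi.add_apply]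
  change 1 / (2 * rad x) * _ = _
  field_simp
  simp
  ring

/-! ### Conservation laws and the radial equation along geodesics -/

section geodesic

variable {γ : ℝ → Coord} {J : Set ℝ} {s : ℝ}

lemma IsGeodesicOn.metric_acc (hγ : IsGeodesicOn M a γ J) (hs : s ∈ J) (w : Coord) :
    metric M a (γ s) (deriv (deriv γ) s) w
      = metricDeriv M a (γ s) w (deriv γ s) (deriv γ s) / 2
        - metricDeriv M a (γ s) (deriv γ s) (deriv γ s) w := by
  have := (hγ s hs).2.2.2 w
  rw [christoffel] at this
  linarith

/-- The derivative of `g(γ', U)` along a geodesic. -/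
lemma IsGeodesicOn.hasDerivAt_metric_right (hγ : IsGeodesicOn M a γ J) (h : |a| < M) (hs : s ∈ J)
    {U : ℝ → Coord} {U' : Coord} (hU : HasDerivAt U U' s) :
    HasDerivAt (fun s => metric M a (γ s) (deriv γ s) (U s))
      (metricDeriv M a (γ s) (U s) (deriv γ s) (deriv γ s) / 2
        + metric M a (γ s) (deriv γ s) U') s := by
  obtain ⟨h1, h2, h3, -⟩ := hγ s hs
  refine (hasDerivAt_metric h h1 h2.hasDerivAt h3.hasDerivAt hU).congr_deriv ?_
  rw [hγ.metric_acc hs]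
  ring

lemma IsGeodesicOn.hasDerivAt_norm (hγ : IsGeodesicOn M a γ J) (h : |a| < M) (hs : s ∈ J) :
    HasDerivAt (fun s => metric M a (γ s) (deriv γ s) (deriv γ s)) 0 s := by
  obtain ⟨h1, h2, h3, -⟩ := hγ s hs
  refine (hasDerivAt_metric h h1 h2.hasDerivAt h3.hasDerivAt h3.hasDerivAt).congr_deriv ?_
  rw [metric_symm _ (deriv γ s), hγ.metric_acc hs]
  ring

/-- Noether's principle: the derivative of `g(γ', U)` along a geodesic is half the Lie derivative of
`g` along the field `U`, evaluated on `γ'`. It vanishes for Killing fields, here `∂ₜ`, and for `∂_φ`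
in the next lemma. -/
lemma IsGeodesicOn.hasDerivAt_energy (hγ : IsGeodesicOn M a γ J) (h : |a| < M) (hs : s ∈ J) :
    HasDerivAt (fun s => energy M a (γ s) (deriv γ s)) 0 s := by
  refine (hγ.hasDerivAt_metric_right h hs (hasDerivAt_const s stat)).neg.congr_deriv ?_
  rw [metricDeriv_stat h (hγ s hs).1]
  simp

lemma IsGeodesicOn.hasDerivAt_angMom (hγ : IsGeodesicOn M a γ J) (h : |a| < M) (hs : s ∈ J) :
    HasDerivAt (fun s => angMom M a (γ s) (deriv γ s)) 0 s := by
  have hd := (hγ s hs).2.1.hasDerivAt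
  refine (hγ.hasDerivAt_metric_right h hs (axial.hasFDerivAt.comp_hasDerivAt s hd)).congr_deriv ?_
  have := metricDeriv_axial h (hγ s hs).1 (deriv γ s) (deriv γ s)
  rw [metric_symm _ (axial _)] at this
  simp only [Function.comp_apply]
  linarith

lemma IsGeodesicOn.hasDerivAt_rad (hγ : IsGeodesicOn M a γ J) (h : |a| < M) (hs : s ∈ J) :
    HasDerivAt (fun s => rad (γ s)) (dr (γ s) (deriv γ s)) s :=
  (hasFDerivAt_rad (rad_pos h (hγ s hs).1)).comp_hasDerivAt s (hγ s hs).2.1.hasDerivAt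

/-- The radial equation of null geodesics. -/
lemma IsGeodesicOn.hasDerivAt_radial (hγ : IsGeodesicOn M a γ J) (h : |a| < M) (hJ : IsOpen J)
    (hs : s ∈ J) (hn : metric M a (γ s) (deriv γ s) (deriv γ s) = 0) :
    HasDerivAt (fun s => rhoSq a (γ s) * dr (γ s) (deriv γ s))
      (((rad (γ s) - M) * (rhoSq a (γ s) * dr (γ s) (deriv γ s)) ^ 2 / Delta M a (γ s)
        + 2 * rad (γ s) * energy M a (γ s) (deriv γ s)
          * (Delta M a (γ s) * tau a (γ s) (deriv γ s))
        - (rad (γ s) - M) * Delta M a (γ s) * tau a (γ s) (deriv γ s) ^ 2) / rhoSq a (γ s)) s := by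
  have hx := (hγ s hs).1
  have hd := (hγ s hs).2.1.hasDerivAt
  have hP := hγ.hasDerivAt_metric_right h hs (euler.hasFDerivAt.comp_hasDerivAt s hd)
  have hr := hγ.hasDerivAt_rad h hs
  have hr0 := rad_pos h hx
  have hρ0 := rhoSq_pos h hx
  have hD0 := Delta_pos h hx
  have hD : HasDerivAt (fun s => Delta M a (γ s))
      (2 * rad (γ s) * dr (γ s) (deriv γ s) - 2 * M * dr (γ s) (deriv γ s)) s :=
    (((hr.pow 2).sub (hr.const_mul (2 * M))).add_const (a ^ 2)).congr_deriv (by norm_num)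
  -- By `metric_euler`, `ρ² r' = g(γ', r ∂_r) Δ / r`, so the derivative is governed by the Lie
  -- derivative of `g` along the Euler field.
  have hu := (hP.mul hD).div hr hr0.ne'
  refine (HasDerivAt.congr_of_eventuallyEq hu (by
    filter_upwards [hJ.mem_nhds hs] with t ht
    have hy := (hγ t ht).1
    have hr1 := rad_pos h hy
    have hρ1 := rhoSq_pos h hy
    have hD1 := Delta_pos h hy
    change _ = metric M a (γ t) (deriv γ t) (euler (γ t)) * Delta M a (γ t) / rad (γ t)
    rw [metric_euler h hy]
    field_simp)).congr_deriv ?_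
  have hL := metricDeriv_euler h hx (deriv γ s)
  have hE := energy_eq (M := M) (a := a) (γ s) (deriv γ s)
  have ht := tau_apply (a := a) (γ s) (deriv γ s)
  have hDd : Delta M a (γ s) = rad (γ s) ^ 2 - 2 * M * rad (γ s) + a ^ 2 := rfl
  rw [null_iff] at hn
  simp only [Function.comp_apply, Pi.mul_apply]
  rw [metric_euler h hx, hE]
  have hL' : metricDeriv M a (γ s) (euler (γ s)) (deriv γ s) (deriv γ s) / 2
      + metric M a (γ s) (deriv γ s) (euler (deriv γ s)) = (_) / 2 :=
    Eq.trans (by ring) (congrArg (· / 2) hL)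
  rw [hL']
  have hm : massFn M a (γ s) = 2 * M * rad (γ s) / rhoSq a (γ s) := rfl
  rw [hm] at hn ⊢
  generalize sinSqDphi (γ s) (deriv γ s) = o at *
  generalize tau a (γ s) (deriv γ s) = τ at *
  generalize dr (γ s) (deriv γ s) = p at *
  have hv : deriv γ s 0 = τ + a * o := by linarith
  rw [hv] at hn ⊢
  clear hL hL' hE hu hD hr hP hd hm hv ht
  generalize hS : spatialDot (deriv γ s) (deriv γ s) = S at *
  clear hS
  -- Nullity is solved for the spatial square of the velocity, which removes the remaining angular
  -- velocity; a rational identity is left.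
  have hS : S = p ^ 2 + rad (γ s) ^ 2 / rhoSq a (γ s) * ((τ + a * o) ^ 2
      - 2 * M * rad (γ s) / rhoSq a (γ s) * τ ^ 2 - a ^ 2 * o ^ 2
      - rhoSq a (γ s) / Delta M a (γ s) * p ^ 2) := by
    rw [← hn]; field_simp; ring
  rw [hS]
  generalize rhoSq a (γ s) = ρ at *
  generalize Delta M a (γ s) = D at *
  generalize rad (γ s) = r at *
  clear hS hn hx
  field_simp
  subst hDd
  ring

end geodesic

/-! ### The Carter constant and critical spheres -/

/-- The radial potential `((r² + a²) E - a L)² - K (r² - 2 M r + a²)`. -/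
def radialPotential (M a E L K r : ℝ) : ℝ :=
  ((r ^ 2 + a ^ 2) * E - a * L) ^ 2 - K * (r ^ 2 - 2 * M * r + a ^ 2)

lemma continuous_radialPotential (E L K : ℝ) : Continuous (radialPotential M a E L K) := by
  unfold radialPotential; fun_prop

/-- The function whose zeros are the critical points of `((r² + a²) E - a L)² / (r² - 2Mr + a²)`. -/
def criticalFn (M a E L r : ℝ) : ℝ :=
  2 * r * E * (r ^ 2 - 2 * M * r + a ^ 2) - (r - M) * ((r ^ 2 + a ^ 2) * E - a * L)

/-- The conserved quantities of a null geodesic and its radial equation in first order form;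
`K` is the Carter constant. -/
lemma IsGeodesicOn.exists_carter {γ : ℝ → Coord} {J : Set ℝ} (hγ : IsGeodesicOn M a γ J)
    (h : |a| < M) (hJ : IsOpen J) (hc : J.OrdConnected) (h0 : 0 ∈ J)
    (hn : metric M a (γ 0) (deriv γ 0) (deriv γ 0) = 0) :
    ∃ K : ℝ, ∀ s ∈ J, metric M a (γ s) (deriv γ s) (deriv γ s) = 0 ∧
      energy M a (γ s) (deriv γ s) = energy M a (γ 0) (deriv γ 0) ∧
      angMom M a (γ s) (deriv γ s) = angMom M a (γ 0) (deriv γ 0) ∧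
      (rhoSq a (γ s) * dr (γ s) (deriv γ s)) ^ 2 = radialPotential M a
        (energy M a (γ 0) (deriv γ 0)) (angMom M a (γ 0) (deriv γ 0)) K (rad (γ s)) := by
  set E := energy M a (γ 0) (deriv γ 0) with hE
  set L := angMom M a (γ 0) (deriv γ 0) with hL
  have cn : ∀ s ∈ J, metric M a (γ s) (deriv γ s) (deriv γ s) = 0 := fun s hs =>
    (eq_of_hasDerivAt_zero hJ hc (fun s hs => hγ.hasDerivAt_norm h hs) hs h0).trans hn
  have cE : ∀ s ∈ J, energy M a (γ s) (deriv γ s) = E := fun s hs =>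
    eq_of_hasDerivAt_zero hJ hc (fun s hs => hγ.hasDerivAt_energy h hs) hs h0
  have cL : ∀ s ∈ J, angMom M a (γ s) (deriv γ s) = L := fun s hs =>
    eq_of_hasDerivAt_zero hJ hc (fun s hs => hγ.hasDerivAt_angMom h hs) hs h0
  -- The Carter constant is found by solving `(ρ² r')² = X² - K Δ` for `K`. The second-order radial
  -- equation is what makes this quotient constant, so the equation for `ϑ` need not be separated.
  have cK : ∀ s ∈ J, HasDerivAt (fun s => (((rad (γ s) ^ 2 + a ^ 2) * E - a * L) ^ 2
      - (rhoSq a (γ s) * dr (γ s) (deriv γ s)) ^ 2)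
        / (rad (γ s) ^ 2 - 2 * M * rad (γ s) + a ^ 2)) 0 s := fun s hs => by
    have hx := (hγ s hs).1
    have hr := hγ.hasDerivAt_rad h hs
    have hρ0 := (rhoSq_pos h hx).ne'
    have hD0 := (Delta_pos h hx).ne'
    have hX := principal_eq h hx (deriv γ s)
    have hu := hγ.hasDerivAt_radial h hJ hs (cn s hs)
    rw [cE s hs] at hu hX
    rw [cL s hs] at hX
    rw [Delta] at hD0
    have key := (((((hr.pow 2).add_const (a ^ 2)).mul_const E).sub_const (a * L)).pow 2 |>.sub
      (hu.pow 2)).div (((hr.pow 2).sub (hr.const_mul (2 * M))).add_const (a ^ 2)) hD0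
    refine HasDerivAt.congr_deriv key ?_
    have hτ : (rad (γ s) ^ 2 + a ^ 2) * E - a * L = Delta M a (γ s) * tau a (γ s) (deriv γ s) := hX
    have hD : rad (γ s) ^ 2 - 2 * M * rad (γ s) + a ^ 2 = Delta M a (γ s) := rfl
    simp only [Pi.pow_apply, Pi.sub_apply]
    rw [hτ, hD]
    rw [hD] at hD0
    field_simp
    simp only [Nat.cast_ofNat, Nat.add_one_sub_one, pow_one]
    rw [Delta] at *
    ring
  refine ⟨(((rad (γ 0) ^ 2 + a ^ 2) * E - a * L) ^ 2
    - (rhoSq a (γ 0) * dr (γ 0) (deriv γ 0)) ^ 2)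
      / (rad (γ 0) ^ 2 - 2 * M * rad (γ 0) + a ^ 2),
    fun s hs => ⟨cn s hs, cE s hs, cL s hs, ?_⟩⟩
  have e := eq_of_hasDerivAt_zero hJ hc cK hs h0
  have hD0 : rad (γ s) ^ 2 - 2 * M * rad (γ s) + a ^ 2 ≠ 0 := (Delta_pos h (hγ s hs).1).ne'
  rw [radialPotential, ← e, div_mul_cancel₀ _ hD0]
  ring

/-- A function with `(f')² ≤ G f²` that vanishes somewhere vanishes everywhere. -/
lemma eq_zero_of_deriv_sq_le {f f' G : ℝ → ℝ} {J : Set ℝ} (hc : J.OrdConnected)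
    (h0 : 0 ∈ J) (hf : ∀ s ∈ J, HasDerivAt f (f' s) s) (hG : ContinuousOn G J)
    (hle : ∀ s ∈ J, f' s ^ 2 ≤ G s * f s ^ 2) (hf0 : f 0 = 0) : ∀ s ∈ J, f s = 0 := by
  have key : ∀ {f f' G : ℝ → ℝ} {J : Set ℝ}, J.OrdConnected → 0 ∈ J →
      (∀ s ∈ J, HasDerivAt f (f' s) s) → ContinuousOn G J →
      (∀ s ∈ J, f' s ^ 2 ≤ G s * f s ^ 2) → f 0 = 0 → ∀ s ∈ J, 0 ≤ s → f s = 0 := by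
    intro f f' G J hc h0 hf hG hle hf0 s hs hs0
    have hsub : Icc 0 s ⊆ J := hc.out h0 hs
    obtain ⟨B, hB⟩ := (isCompact_Icc.image_of_continuousOn (hG.mono hsub)).bddAbove
    have hB' : ∀ t ∈ Icc 0 s, G t ≤ B := fun t ht => hB (mem_image_of_mem G ht)
    -- Gronwall on the compact interval `[0, s]`, where `G` has an upper bound `B`. Negative
    -- parameters are treated below by reflection.
    refine eq_zero_of_abs_deriv_le_mul_abs_self_of_eq_zero_right (K := √(max B 0)) (a := 0)
      (b := s) (f := f) (f' := f')
      (fun t ht => (hf t (hsub ht)).continuousAt.continuousWithinAt)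
      (fun t ht => (hf t (hsub (Ico_subset_Icc_self ht))).hasDerivWithinAt) hf0 ?_ s
      ⟨hs0, le_rfl⟩
    intro t ht
    have ht' := Ico_subset_Icc_self ht
    rw [Real.norm_eq_abs, Real.norm_eq_abs]
    refine abs_le_of_sq_le_sq ?_ (by positivity)
    rw [mul_pow, Real.sq_sqrt (le_max_right _ _), sq_abs]
    exact (hle t (hsub ht')).trans (mul_le_mul_of_nonneg_right
      ((hB' t ht').trans (le_max_left _ _)) (sq_nonneg _))
  intro s hs
  rcases le_total 0 s with hs0 | hs0
  · exact key hc h0 hf hG hle hf0 s hs hs0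
  · have hneg : ∀ t ∈ Neg.neg ⁻¹' J, HasDerivAt (fun t => f (-t)) (-f' (-t)) t := fun t ht =>
      ((hf (-t) ht).comp t (hasDerivAt_neg t)).congr_deriv (by simp)
    have hc' : (Neg.neg ⁻¹' J : Set ℝ).OrdConnected :=
      ⟨fun x hx y hy z hz => hc.out hy hx ⟨neg_le_neg hz.2, neg_le_neg hz.1⟩⟩
    have := key (f := fun t => f (-t)) (f' := fun t => -f' (-t)) (G := fun t => G (-t))
      (J := Neg.neg ⁻¹' J) hc' (by simpa using h0) hneg
      (hG.comp continuous_neg.continuousOn fun t ht => ht)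
      (fun t ht => by simpa using hle (-t) ht) (by simpa using hf0) (-s) (by simpa using hs)
      (by linarith)
    simpa using this

/-- At a double zero the radial potential factors. -/
lemma radialPotential_eq_of_critical {E L K r₀ : ℝ} (hr₀ : r₀ ^ 2 - 2 * M * r₀ + a ^ 2 ≠ 0)
    (h0 : radialPotential M a E L K r₀ = 0) (h1 : criticalFn M a E L r₀ = 0) (r : ℝ) :
    radialPotential M a E L K r = (2 * ((r₀ ^ 2 + a ^ 2) * E - a * L) * E
      + E ^ 2 * (r + r₀) ^ 2 - K) * (r - r₀) ^ 2 := by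
  unfold radialPotential criticalFn at *
  set X := (r₀ ^ 2 + a ^ 2) * E - a * L with hX
  -- This is `R'(r₀) = 0`, up to a factor 2: together with `R(r₀) = 0` it says that `r₀` is a double
  -- zero.
  have h2 : 2 * r₀ * X * E = K * (r₀ - M) := by
    refine mul_left_cancel₀ hr₀ ?_
    linear_combination X * h1 + (r₀ - M) * h0
  have hXr : (r ^ 2 + a ^ 2) * E - a * L = X + E * (r - r₀) * (r + r₀) := by rw [hX]; ring
  rw [hXr]
  linear_combination h0 + 2 * (r - r₀) * h2

/-- Geodesics that start tangentially to a critical sphere stay on this sphere. -/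
lemma IsGeodesicOn.rad_eq_of_critical {γ : ℝ → Coord} {J : Set ℝ} (hγ : IsGeodesicOn M a γ J)
    (h : |a| < M) (hJ : IsOpen J) (hc : J.OrdConnected) (h0 : 0 ∈ J)
    (hn : metric M a (γ 0) (deriv γ 0) (deriv γ 0) = 0) (hdr : dr (γ 0) (deriv γ 0) = 0)
    (hq : criticalFn M a (energy M a (γ 0) (deriv γ 0)) (angMom M a (γ 0) (deriv γ 0))
      (rad (γ 0)) = 0) {s : ℝ} (hs : s ∈ J) : rad (γ s) = rad (γ 0) := by
  obtain ⟨K, hK⟩ := hγ.exists_carter h hJ hc h0 hn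
  set E := energy M a (γ 0) (deriv γ 0)
  set L := angMom M a (γ 0) (deriv γ 0)
  have hD := (Delta_pos h (hγ 0 h0).1).ne'
  have hR0 : radialPotential M a E L K (rad (γ 0)) = 0 := by
    rw [← (hK 0 h0).2.2.2, hdr]; ring
  have hM := mass_pos h
  have hcr : ContinuousOn (fun s => rad (γ s)) J :=
    fun s hs => (hγ.hasDerivAt_rad h hs).continuousAt.continuousWithinAt
  -- The double zero gives `(ρ² r')² = Q(r) (r - r₀)²`. As `ρ² ≥ r² ≥ M²`, this implies `r'² ≤ (|Q|
  -- / M⁴) (r - r₀)²`, which forces `r = r₀`.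
  refine sub_eq_zero.1 (eq_zero_of_deriv_sq_le (f := fun s => rad (γ s) - rad (γ 0))
    (f' := fun s => dr (γ s) (deriv γ s))
    (G := fun s => |2 * ((rad (γ 0) ^ 2 + a ^ 2) * E - a * L) * E
      + E ^ 2 * (rad (γ s) + rad (γ 0)) ^ 2 - K| / M ^ 4) hc h0
    (fun s hs => (hγ.hasDerivAt_rad h hs).sub_const _) ?_ ?_ (by simp) s hs)
  · fun_prop
  · intro t ht
    have hx := (hγ t ht).1
    have hMr := lt_rad _ hx
    have e := (hK t ht).2.2.2
    rw [radialPotential_eq_of_critical hD hR0 hq] at e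
    have h1 : M ^ 2 ≤ rhoSq a (γ t) :=
      (pow_le_pow_left₀ hM.le hMr.le 2).trans (rad_sq_le_rhoSq _)
    have h2 : M ^ 4 ≤ rhoSq a (γ t) ^ 2 := by nlinarith [sq_nonneg M]
    rw [div_mul_eq_mul_div, le_div_iff₀ (by positivity)]
    calc dr (γ t) (deriv γ t) ^ 2 * M ^ 4 ≤ dr (γ t) (deriv γ t) ^ 2 * rhoSq a (γ t) ^ 2 := by gcongr
      _ = (rhoSq a (γ t) * dr (γ t) (deriv γ t)) ^ 2 := by ring
      _ ≤ _ := by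
        rw [e]
        exact mul_le_mul_of_nonneg_right (le_abs_self _) (sq_nonneg _)

/-! ### Spherical photons are trapped -/

/-- The explicit description of the photon region: tangent vectors of null geodesics
on spheres `r = const`. -/
def sphericalPhotons (M a : ℝ) : Set (Coord × Coord) :=
  {z | z.1 ∈ doc M a ∧ metric M a z.1 z.2 z.2 = 0 ∧ 0 < z.2 0 ∧ dr z.1 z.2 = 0 ∧
    criticalFn M a (energy M a z.1 z.2) (angMom M a z.1 z.2) (rad z.1) = 0}

/-- Every geodesic with such data stays at its initial radius, so the coordinate sphere of that
radius serves as the compact set. -/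
lemma sphericalPhotons_subset (h : |a| < M) : sphericalPhotons M a ⊆ photonRegion M a := by
  rintro ⟨x, p⟩ ⟨hx, hn, hp, hdr, hq⟩
  simp only at hx hn hp hdr hq
  refine ⟨hx, hn, hp, {y | y 0 ^ 2 + y 1 ^ 2 + y 2 ^ 2 = rad x ^ 2}, ?_, ?_, ?_⟩
  · refine Metric.isCompact_of_isClosed_isBounded
      (isClosed_eq (by fun_prop) continuous_const) ?_
    refine (Metric.isBounded_closedBall (x := (0 : Fin 3 → ℝ)) (r := rad x)).subset fun y hy => ?_
    rw [mem_closedBall_zero_iff, pi_norm_le_iff_of_nonneg (rad_pos h hx).le]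
    intro i
    rw [Real.norm_eq_abs]
    refine abs_le_of_sq_le_sq ?_ (rad_pos h hx).le
    rw [← hy.out]
    fin_cases i <;> simp only [Fin.zero_eta, Fin.mk_one, Fin.reduceFinMk] <;>
      nlinarith [sq_nonneg (y 0), sq_nonneg (y 1), sq_nonneg (y 2)]
  · intro y hy
    refine ⟨![0, y 0, y 1, y 2], ?_, ?_⟩
    · change _ < √(y 0 ^ 2 + y 1 ^ 2 + y 2 ^ 2)
      rw [hy.out, Real.sqrt_sq (rad_pos h hx).le]
      exact hx
    · ext i; fin_cases i <;> rfl
  · intro γ J hJ hc h0 hγ hγ0 hγ1 s hs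
    simp only at hγ0 hγ1
    have := hγ.rad_eq_of_critical h hJ hc h0 (by rwa [hγ0, hγ1]) (by rwa [hγ0, hγ1])
      (by rwa [hγ0, hγ1]) hs
    change γ s 1 ^ 2 + γ s 2 ^ 2 + γ s 3 ^ 2 = rad x ^ 2
    rw [← hγ0, ← this, rad_sq, spatialDot]
    ring

/-! ### Bounded solutions of the radial equation -/

/-- A differentiable function on `ℝ` that is bounded above has almost critical points at which it is
close to its supremum. -/
lemma exists_deriv_small_near_sSup {f f' : ℝ → ℝ} (hf : ∀ s, HasDerivAt f (f' s) s)
    (hb : BddAbove (range f)) {ε : ℝ} (hε : 0 < ε) :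
    ∃ s, sSup (range f) - ε < f s ∧ |f' s| < ε := by
  set S := sSup (range f)
  have hS : ∀ s, f s ≤ S := fun s => le_csSup hb (mem_range_self s)
  obtain ⟨_, ⟨s₀, rfl⟩, hs₀⟩ := exists_lt_of_lt_csSup (range_nonempty f)
    (show S - ε / 2 < S by linarith)
  obtain ⟨d, hd, hd1, hd2⟩ : ∃ d : ℝ, 0 < d ∧ d * s₀ ^ 2 ≤ ε / 4 ∧ 4 * d * ε < ε ^ 2 := by
    refine ⟨min (ε / (4 * (s₀ ^ 2 + 1))) (ε / 8), by positivity, ?_, ?_⟩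
    · calc _ ≤ ε / (4 * (s₀ ^ 2 + 1)) * s₀ ^ 2 := by gcongr; exact min_le_left _ _
        _ ≤ ε / 4 := by
          rw [div_mul_eq_mul_div, div_le_div_iff₀ (by positivity) (by norm_num)]
          nlinarith
    · have := min_le_right (ε / (4 * (s₀ ^ 2 + 1))) (ε / 8)
      nlinarith
  -- The supremum of `f` need not be attained, but the penalised function `f - d s²` attains its
  -- maximum. There `f' = 2 d s` and `d s² < ε`, so `f'² < 4 d ε < ε²`; comparison with `s₀` keeps
  -- `f` near its supremum.
  set g : ℝ → ℝ := fun s => f s - d * s ^ 2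
  have hgc : Continuous g :=
    (continuous_iff_continuousAt.2 fun s => (hf s).continuousAt).sub (by fun_prop)
  have hlim : Tendsto g (cocompact ℝ) atBot := by
    refine tendsto_atBot_mono (fun s => (?_ : g s ≤ S + -(d * ‖s‖ ^ 2))) ?_
    · rw [Real.norm_eq_abs, sq_abs]
      have := hS s
      simp only [g]; linarith
    · exact tendsto_atBot_add_const_left _ _ (tendsto_neg_atTop_atBot.comp
        (((tendsto_pow_atTop two_ne_zero).comp (tendsto_norm_cocompact_atTop (E := ℝ))).const_mul_atTop hd))
  obtain ⟨s, hs⟩ := hgc.exists_forall_ge hlim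
  have hg' : HasDerivAt g (f' s - d * (2 * s)) s :=
    ((hf s).sub (((hasDerivAt_pow 2 s)).const_mul d)).congr_deriv (by norm_num)
  have hz := (show IsLocalMax g s from Filter.Eventually.of_forall hs).hasDerivAt_eq_zero hg'
  have h0 := hs s₀
  have hss := hS s
  simp only [g] at h0
  have hds : 0 ≤ d * s ^ 2 := by positivity
  refine ⟨s, by linarith, ?_⟩
  refine abs_lt_of_sq_lt_sq ?_ hε.le
  rw [show f' s = d * (2 * s) by linarith]
  have : d * s ^ 2 < ε := by linarith
  nlinarith

/-- If `F ∘ f` is controlled by `f'`, then `F` vanishes at the supremum of `f`. -/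
lemma apply_sSup_eq_zero {f f' F : ℝ → ℝ} (hf : ∀ s, HasDerivAt f (f' s) s)
    (hb : BddAbove (range f)) (hF : Continuous F) {C : ℝ}
    (hle : ∀ s, |F (f s)| ≤ C * f' s ^ 2) : F (sSup (range f)) = 0 := by
  choose s hs1 hs2 using fun n : ℕ =>
    exists_deriv_small_near_sSup hf hb (Nat.one_div_pos_of_nat (α := ℝ) (n := n))
  have h0 := tendsto_one_div_add_atTop_nhds_zero_nat (𝕜 := ℝ)
  have h1 : Tendsto (fun n => f (s n)) atTop (𝓝 (sSup (range f))) := by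
    refine tendsto_of_tendsto_of_tendsto_of_le_of_le (by simpa using h0.const_sub (sSup (range f)))
      tendsto_const_nhds (fun n => (hs1 n).le) (fun n => le_csSup hb (mem_range_self _))
  have h2 : Tendsto (fun n => f' (s n)) atTop (𝓝 0) :=
    squeeze_zero_norm (fun n => (hs2 n).le) h0
  have h3 : Tendsto (fun n => F (f (s n))) atTop (𝓝 0) :=
    squeeze_zero_norm (fun n => hle (s n)) (by simpa using (h2.pow 2).const_mul C)
  exact tendsto_nhds_unique ((hF.tendsto _).comp h1) h3

/-- At a critical point `c` the quotient `((r² + a²) E - a L)² / (r² - 2Mr + a²)` is smaller than at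
all larger radii. -/
lemma lt_of_criticalFn_eq_zero (h : |a| < M) {E L c r : ℝ} (hc : M < c)
    (hD : 0 < c ^ 2 - 2 * M * c + a ^ 2) (hq : criticalFn M a E L c = 0)
    (hX : (c ^ 2 + a ^ 2) * E - a * L ≠ 0) (hr : c < r) :
    ((c ^ 2 + a ^ 2) * E - a * L) ^ 2 * (r ^ 2 - 2 * M * r + a ^ 2)
      < ((r ^ 2 + a ^ 2) * E - a * L) ^ 2 * (c ^ 2 - 2 * M * c + a ^ 2) := by
  have ha := sq_lt_mass_sq h
  have hM := mass_pos h
  unfold criticalFn at hq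
  set X := (c ^ 2 + a ^ 2) * E - a * L with hXd
  have hXr : (r ^ 2 + a ^ 2) * E - a * L = X + E * (r - c) * (r + c) := by rw [hXd]; ring
  rw [hXr]
  have hk : 0 < c - M := by linarith
  have hE : E ≠ 0 := by
    rintro rfl
    have : (c - M) * X = 0 := by linarith
    exact hX ((mul_eq_zero.1 this).resolve_left hk.ne')
  have hDr : r ^ 2 - 2 * M * r + a ^ 2
      = (c ^ 2 - 2 * M * c + a ^ 2) + 2 * (c - M) * (r - c) + (r - c) ^ 2 := by ring
  rw [hDr]
  have hkD : (c - M) ^ 2 = (c ^ 2 - 2 * M * c + a ^ 2) + (M ^ 2 - a ^ 2) := by ring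
  set D := c ^ 2 - 2 * M * c + a ^ 2
  clear_value X
  have hkX : (c - M) * X = 2 * c * E * D := by linear_combination -hq
  set k := c - M
  -- Multiplied by `k²`, and with `k X = 2 c E D` substituted, the difference of the two sides is
  -- `E² D (r - c)²` times this bracket. The bracket is positive because `a² < M²` gives `D ≤ k²`,
  -- and `2 c ≤ r + c`.
  have hb : 0 < 4 * c * D * k + k ^ 2 * (r + c) ^ 2 - 4 * c ^ 2 * D := by
    have h1 : (2 * c) ^ 2 ≤ (r + c) ^ 2 := pow_le_pow_left₀ (by linarith) (by linarith) 2
    have h2 : D ≤ k ^ 2 := by linarith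
    have h3 : 0 < c * D * k := by have := hM.trans hc; positivity
    have h4 : D * (2 * c) ^ 2 ≤ k ^ 2 * (r + c) ^ 2 :=
      mul_le_mul h2 h1 (by positivity) (by positivity)
    linarith
  have hpos : 0 < E ^ 2 * D * (r - c) ^ 2
      * (4 * c * D * k + k ^ 2 * (r + c) ^ 2 - 4 * c ^ 2 * D) := by
    have : 0 < r - c := by linarith
    positivity
  have hid : k ^ 2 * ((X + E * (r - c) * (r + c)) ^ 2 * D
      - X ^ 2 * (D + 2 * k * (r - c) + (r - c) ^ 2))
      = E ^ 2 * D * (r - c) ^ 2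
      * (4 * c * D * k + k ^ 2 * (r + c) ^ 2 - 4 * c ^ 2 * D) := by
    have e : k * (X + E * (r - c) * (r + c)) = 2 * c * E * D + k * E * (r - c) * (r + c) := by
      rw [mul_add, hkX]; ring
    calc _ = (k * (X + E * (r - c) * (r + c))) ^ 2 * D
        - (k * X) ^ 2 * (D + 2 * k * (r - c) + (r - c) ^ 2) := by ring
      _ = _ := by rw [e, hkX]; ring
  rw [← hid] at hpos
  exact sub_pos.1 (pos_of_mul_pos_right hpos (by positivity))

/-- Bounded solutions of the radial equation are constant. -/
lemma eq_of_radial_bounded (h : |a| < M) {E L K B r₁ r₂ : ℝ} {r r' ρ : ℝ → ℝ}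
    (hr : ∀ s, HasDerivAt r (r' s) s)
    (hR : ∀ s, (ρ s * r' s) ^ 2 = radialPotential M a E L K (r s))
    (hρ : ∀ s, ρ s ^ 2 ≤ B) (hX : ∀ s, (r s ^ 2 + a ^ 2) * E - a * L ≠ 0)
    (h₁ : M + √(M ^ 2 - a ^ 2) < r₁) (hr₁ : ∀ s, r₁ ≤ r s) (hr₂ : ∀ s, r s ≤ r₂) (s t : ℝ) :
    r s = r t := by
  have hcont : Continuous r := continuous_iff_continuousAt.2 fun s => (hr s).continuousAt
  have hba : BddAbove (range r) := ⟨r₂, by rintro _ ⟨s, rfl⟩; exact hr₂ s⟩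
  have hbb : BddBelow (range r) := ⟨r₁, by rintro _ ⟨s, rfl⟩; exact hr₁ s⟩
  have hle : ∀ s, |radialPotential M a E L K (r s)| ≤ B * r' s ^ 2 := fun s => by
    rw [← hR, abs_of_nonneg (sq_nonneg _), mul_pow]
    exact mul_le_mul_of_nonneg_right (hρ s) (sq_nonneg _)
  have hS := apply_sSup_eq_zero hr hba (continuous_radialPotential E L K) hle
  -- The infimum is handled as the supremum of `-r`.
  have hI : radialPotential M a E L K (sInf (range r)) = 0 := by
    have hb' : BddAbove (range fun s => -r s) :=
      ⟨-r₁, by rintro _ ⟨s, rfl⟩; exact neg_le_neg (hr₁ s)⟩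
    have := apply_sSup_eq_zero (f := fun s => -r s) (F := fun y => radialPotential M a E L K (-y))
      (fun s => (hr s).neg) hb' ((continuous_radialPotential E L K).comp continuous_neg)
      (C := B) (fun s => by simpa using hle s)
    rw [Real.sInf_def]
    convert this using 4
    ext y
    simp [neg_eq_iff_eq_neg]
  set S := sSup (range r)
  set I := sInf (range r)
  have hrS : ∀ s, r s ≤ S := fun s => le_csSup hba (mem_range_self s)
  have hrI : ∀ s, I ≤ r s := fun s => csInf_le hbb (mem_range_self s)
  suffices hIS : S ≤ I from
    le_antisymm ((hrS s).trans (hIS.trans (hrI t))) ((hrS t).trans (hIS.trans (hrI s)))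
  by_contra! hlt
  have hIr : r₁ ≤ I := le_csInf (range_nonempty r) (by rintro _ ⟨s, rfl⟩; exact hr₁ s)
  have hD : ∀ y, I ≤ y → 0 < y ^ 2 - 2 * M * y + a ^ 2 := fun y hy =>
    horizon_pos h (h₁.trans_le (hIr.trans hy))
  have hmem : ∀ y ∈ Ioo I S, ∃ s, r s = y := fun y hy => by
    obtain ⟨_, ⟨s1, rfl⟩, h1⟩ := exists_lt_of_csInf_lt (range_nonempty r) hy.1
    obtain ⟨_, ⟨s2, rfl⟩, h2⟩ := exists_lt_of_lt_csSup (range_nonempty r) hy.2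
    exact mem_range_of_exists_le_of_exists_ge hcont ⟨s1, h1.le⟩ ⟨s2, h2.le⟩
  set Φ : ℝ → ℝ := fun y => ((y ^ 2 + a ^ 2) * E - a * L) ^ 2 / (y ^ 2 - 2 * M * y + a ^ 2)
  have hΦ0 : ∀ y, I ≤ y → radialPotential M a E L K y = 0 → Φ y = K := fun y hy h0 => by
    simp only [Φ]
    rw [div_eq_iff (hD y hy).ne']
    unfold radialPotential at h0
    linarith
  have hΦ1 : ∀ y ∈ Ioo I S, K ≤ Φ y := fun y hy => by
    obtain ⟨s, rfl⟩ := hmem y hy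
    simp only [Φ]
    rw [le_div_iff₀ (hD _ hy.1.le)]
    have h0 : 0 ≤ radialPotential M a E L K (r s) := by rw [← hR]; positivity
    unfold radialPotential at h0
    linarith
  have hΦc : ContinuousOn Φ (Icc I S) := by
    refine ContinuousOn.div (by fun_prop) (by fun_prop) fun y hy => (hD y hy.1).ne'
  -- If the maximum sits at an endpoint its value is `K`. Since `Φ ≥ K` inside, the midpoint is then
  -- a maximum as well, so an interior one always exists.
  obtain ⟨c, hc, hmax⟩ : ∃ c ∈ Ioo I S, ∀ y ∈ Icc I S, Φ y ≤ Φ c := by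
    obtain ⟨c, hc, hmax⟩ := isCompact_Icc.exists_isMaxOn (nonempty_Icc.2 hlt.le) hΦc
    by_cases hci : c ∈ Ioo I S
    · exact ⟨c, hci, fun y hy => hmax hy⟩
    · have hcK : Φ c = K := by
        rcases eq_or_lt_of_le hc.1 with h1 | h1
        · exact h1 ▸ hΦ0 I le_rfl hI
        · have h2 : c = S := le_antisymm hc.2 (not_lt.1 fun h2 => hci ⟨h1, h2⟩)
          exact h2 ▸ hΦ0 S hlt.le hS
      have hmid : (I + S) / 2 ∈ Ioo I S := ⟨by linarith, by linarith⟩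
      exact ⟨_, hmid, fun y hy => ((hmax hy : Φ y ≤ Φ c).trans hcK.le).trans (hΦ1 _ hmid)⟩
  have hDc := hD c hc.1.le
  have hMc : M < c := by
    have := Real.sqrt_nonneg (M ^ 2 - a ^ 2)
    linarith [hc.1]
  obtain ⟨s₀, hs₀⟩ := hmem c hc
  have hXc : (c ^ 2 + a ^ 2) * E - a * L ≠ 0 := hs₀ ▸ hX s₀
  have hder : HasDerivAt Φ (2 * ((c ^ 2 + a ^ 2) * E - a * L) * criticalFn M a E L c
      / (c ^ 2 - 2 * M * c + a ^ 2) ^ 2) c := by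
    have h2 := hasDerivAt_pow 2 c
    have := ((((h2.add_const (a ^ 2)).mul_const E).sub_const (a * L)).pow 2).div
      ((h2.sub ((hasDerivAt_id c).const_mul (2 * M))).add_const (a ^ 2)) hDc.ne'
    refine HasDerivAt.congr_deriv this ?_
    simp only [criticalFn, Pi.pow_apply, Pi.sub_apply, id]
    congr 1
    norm_num
    ring
  have hloc : IsLocalMax Φ c :=
    Filter.mem_of_superset (Icc_mem_nhds hc.1 hc.2) fun y hy => hmax y hy
  have hz := hloc.hasDerivAt_eq_zero hder
  have hq : criticalFn M a E L c = 0 := by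
    rw [div_eq_zero_iff, or_iff_left (pow_pos hDc 2).ne', mul_eq_zero] at hz
    exact hz.resolve_left (mul_ne_zero two_ne_zero hXc)
  have hfin := lt_of_criticalFn_eq_zero h hMc hDc hq hXc hc.2
  have hle := hmax S ⟨hlt.le, le_rfl⟩
  simp only [Φ] at hle
  rw [div_le_div_iff₀ (hD S hlt.le) hDc] at hle
  linarith

/-! ### Global integral curves -/

section ODE

variable {E : Type*} [NormedAddCommGroup E] [NormedSpace ℝ E]

/-- A bounded globally Lipschitz vector field has global integral curves. -/
lemma exists_global_integralCurve [CompleteSpace E] {F : E → E} {K L : ℝ≥0}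
    (hF : LipschitzWith K F) (hb : ∀ x, ‖F x‖ ≤ L) (x₀ : E) :
    ∃ z : ℝ → E, z 0 = x₀ ∧ ∀ s, HasDerivAt z (F (z s)) s := by
  have hloc : ∀ n : ℕ, ∃ α : ℝ → E, α 0 = x₀ ∧
      ∀ t ∈ Ioo (-(n + 1 : ℝ)) (n + 1), HasDerivAt α (F (α t)) t := fun n => by
    have h0 : (0 : ℝ) ∈ Icc (-(n + 1 : ℝ)) (n + 1) :=
      ⟨by linarith [n.cast_nonneg (α := ℝ)], by positivity⟩
    -- A curve of speed at most `L` cannot leave the ball of radius `L (n + 1)` within time `n + 1`,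
    -- so Picard-Lindelöf applies on the whole interval.
    have := IsPicardLindelof.of_time_independent (f := F) (t₀ := ⟨0, h0⟩) (x₀ := x₀)
      (a := L * (n + 1)) (r := 0) (fun x _ => hb x) hF.lipschitzOnWith (by simp)
    obtain ⟨α, hα0, hα⟩ := this.exists_eq_forall_mem_Icc_hasDerivWithinAt₀
    exact ⟨α, hα0, fun t ht => (hα t (Ioo_subset_Icc_self ht)).hasDerivAt (Icc_mem_nhds ht.1 ht.2)⟩
  choose α hα0 hα using hloc
  have hagree : ∀ m n : ℕ, ∀ t ∈ Ioo (-(m + 1 : ℝ)) (m + 1), t ∈ Ioo (-(n + 1 : ℝ)) (n + 1) →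
      α m t = α n t := fun m n => by
    have key : ∀ m n : ℕ, m ≤ n → ∀ t ∈ Ioo (-(m + 1 : ℝ)) (m + 1), α m t = α n t := by
      intro m n hmn
      have hmn' : (m : ℝ) ≤ n := by exact_mod_cast hmn
      refine ODE_solution_unique_of_mem_Ioo (v := fun _ => F) (s := fun _ => univ) (K := K)
        (t₀ := 0) (fun _ _ => hF.lipschitzOnWith)
        ⟨by linarith [m.cast_nonneg (α := ℝ)], by positivity⟩ (fun t ht => ⟨hα m t ht, trivial⟩)
        (fun t ht => ⟨hα n t ⟨by linarith [ht.1], by linarith [ht.2]⟩, trivial⟩) ?_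
      rw [hα0, hα0]
    intro t hm hn
    rcases le_total m n with h | h
    · exact key m n h t hm
    · exact (key n m h t hn).symm
  have hmem : ∀ t : ℝ, t ∈ Ioo (-((⌈|t|⌉₊ : ℕ) + 1 : ℝ)) ((⌈|t|⌉₊ : ℕ) + 1) := fun t => by
    have := Nat.le_ceil |t|
    exact abs_lt.1 (by linarith)
  refine ⟨fun t => α ⌈|t|⌉₊ t, by simp [hα0], fun s => ?_⟩
  refine (hα _ s (hmem s)).congr_of_eventuallyEq ?_
  filter_upwards [Ioo_mem_nhds (hmem s).1 (hmem s).2] with t ht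
  exact hagree _ _ t (hmem t) ht

/-- A vector field that depends only on a linear image `p z` of the point has integral curves that
are defined for all times, as long as one only requires the differential equation
for `p z` in a neighbourhood of a given compact set. -/
lemma exists_integralCurve_near_compact [FiniteDimensional ℝ E] {U N : Set E} (hU : IsOpen U)
    (hN : IsCompact N) (hNU : N ⊆ U) {f : E → E} (hf : ContDiffOn ℝ 1 f U) (p : E →L[ℝ] E)
    (z₀ : E) : ∃ (z : ℝ → E) (V : Set E), IsOpen V ∧ N ⊆ V ∧ V ⊆ U ∧ Continuous z ∧ z 0 = z₀ ∧
      ∀ s, p (z s) ∈ V → HasDerivAt z (f (p (z s))) s := by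
  have := FiniteDimensional.complete ℝ E
  obtain ⟨T, hT, hNT, hTU⟩ := exists_compact_between hN hU hNU
  obtain ⟨χ, h1, h0, -⟩ := exists_contMDiffMap_one_nhds_of_subset_interior (n := 1) 𝓘(ℝ, E)
    hN.isClosed hNT
  have hχ : ContDiff ℝ 1 χ := χ.contMDiff.contDiff
  obtain ⟨V, hV, hNV, hV1⟩ := eventually_nhdsSet_iff_exists.1 h1
  -- The cutoff `χ` is 1 near `N` and vanishes off a compact subset of `U`, so `G` is compactly
  -- supported and `C¹`, hence bounded and Lipschitz, and agrees with `f` on `V`.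
  set G : E → E := fun y => χ y • f y
  have hG : ContDiff ℝ 1 G := by
    rw [contDiff_iff_contDiffAt]
    intro y
    by_cases hy : y ∈ U
    · exact hχ.contDiffAt.smul (hf.contDiffAt (hU.mem_nhds hy))
    · refine (contDiffAt_const (c := (0 : E))).congr_of_eventuallyEq ?_
      filter_upwards [hT.isClosed.isOpen_compl.mem_nhds fun h => hy (hTU h)] with w hw
      simp [G, h0 w hw]
  have hGs : HasCompactSupport G := HasCompactSupport.intro hT fun y hy => by simp [G, h0 y hy]
  obtain ⟨K, hK⟩ := hG.lipschitzWith_of_hasCompactSupport hGs one_ne_zero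
  obtain ⟨C, hC⟩ := hGs.exists_bound_of_continuous hG.continuous
  obtain ⟨z, hz0, hz⟩ := exists_global_integralCurve (F := G ∘ p) (L := Real.toNNReal C)
    (hK.comp p.lipschitz) (fun x => (hC _).trans (Real.le_coe_toNNReal C)) z₀
  refine ⟨z, V ∩ U, hV.inter hU, subset_inter hNV hNU, inter_subset_right,
    continuous_iff_continuousAt.2 fun s => (hz s).continuousAt, hz0, fun s hs => ?_⟩
  have := hz s
  simp only [Function.comp_apply, G, hV1 _ hs.1, one_smul] at this
  exact this

end ODE

/-! ### The geodesic flow and completeness of trapped photons -/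

/-- The one-form `w ↦ g(∇_v v, w)` for a constant vector `v`. -/
def christoffelForm (M a : ℝ) (x v : Coord) : Coord →L[ℝ] ℝ :=
  fderiv ℝ (metric M a) x v v - (1 / 2 : ℝ) • ((fderiv ℝ (metric M a) x).flip v).flip v

lemma christoffelForm_apply (h : |a| < M) {x : Coord} (hx : x ∈ doc M a) (v w : Coord) :
    christoffelForm M a x v w = christoffel M a x v v w := by
  simp only [christoffelForm, christoffel, metricDeriv_eq h hx, sub_apply, smul_apply,
    ContinuousLinearMap.flip_apply, smul_eq_mul]
  ring

/-- The geodesic vector field on the tangent bundle. -/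
def geodesicField (M a : ℝ) (z : Coord × Coord) : Coord × Coord :=
  (z.2, -(metric M a z.1).inverse (christoffelForm M a z.1 z.2))

lemma isOpen_tangentBundle : IsOpen (tangentBundle M a) := isOpen_doc.preimage continuous_fst

lemma contDiffAt_metric_fst (h : |a| < M) {z : Coord × Coord} (hz : z.1 ∈ doc M a) :
    ContDiffAt ℝ ∞ (fun z : Coord × Coord => metric M a z.1) z :=
  (contDiffAt_metric h hz).comp z contDiffAt_fst

lemma contDiffAt_metric_inverse (h : |a| < M) {x : Coord} (hx : x ∈ doc M a) :
    ContDiffAt ℝ ∞ (fun x => (metric M a x).inverse) x :=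
  ((metric_isInvertible h hx).contDiffAt_map_inverse).comp x (contDiffAt_metric h hx)

lemma contDiffAt_flip {E F G H : Type*} [NormedAddCommGroup E] [NormedSpace ℝ E]
    [NormedAddCommGroup F] [NormedSpace ℝ F] [NormedAddCommGroup G] [NormedSpace ℝ G]
    [NormedAddCommGroup H] [NormedSpace ℝ H] {n : WithTop ℕ∞} {f : H → E →L[ℝ] F →L[ℝ] G} {x : H}
    (hf : ContDiffAt ℝ n f x) : ContDiffAt ℝ n (fun y => (f y).flip) x :=
  (ContinuousLinearMap.flipₗᵢ ℝ E F G).contDiff.contDiffAt.comp x hf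

lemma contDiffAt_fderiv_metric (h : |a| < M) {z : Coord × Coord} (hz : z.1 ∈ doc M a) :
    ContDiffAt ℝ ∞ (fun z : Coord × Coord => fderiv ℝ (metric M a) z.1) z := by
  have h1 : ContDiffAt ℝ ∞ (fderiv ℝ (metric M a)) z.1 :=
    (contDiffAt_metric h hz).fderiv_right (by simp)
  exact h1.comp z contDiffAt_fst

lemma contDiffAt_christoffelForm (h : |a| < M) {z : Coord × Coord} (hz : z.1 ∈ doc M a) :
    ContDiffAt ℝ ∞ (fun z : Coord × Coord => christoffelForm M a z.1 z.2) z := by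
  have hD := contDiffAt_fderiv_metric h hz
  have hv : ContDiffAt ℝ ∞ (fun z : Coord × Coord => z.2) z := contDiffAt_snd
  have h1 := (hD.clm_apply hv).clm_apply hv
  have h2 := (contDiffAt_flip hD).clm_apply hv
  have h3 := (contDiffAt_flip h2).clm_apply hv
  exact h1.sub (h3.const_smul (1 / 2 : ℝ))

lemma contDiffAt_geodesicField (h : |a| < M) {z : Coord × Coord} (hz : z.1 ∈ doc M a) :
    ContDiffAt ℝ ∞ (geodesicField M a) z := by
  have h4 : ContDiffAt ℝ ∞ (fun z : Coord × Coord => (metric M a z.1).inverse) z :=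
    (contDiffAt_metric_inverse h hz).comp z contDiffAt_fst
  exact contDiffAt_snd.prodMk (h4.clm_apply (contDiffAt_christoffelForm h hz)).neg

lemma isGeodesicOn_of_integralCurve (h : |a| < M) {z : ℝ → Coord × Coord} {J : Set ℝ}
    (hJ : IsOpen J) (hd : ∀ s ∈ J, (z s).1 ∈ doc M a)
    (hz : ∀ s ∈ J, HasDerivAt z (geodesicField M a (z s)) s) :
    IsGeodesicOn M a (fun s => (z s).1) J ∧ ∀ s ∈ J, deriv (fun s => (z s).1) s = (z s).2 := by
  have h1 : ∀ s ∈ J, HasDerivAt (fun s => (z s).1) (z s).2 s := fun s hs =>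
    (ContinuousLinearMap.fst ℝ Coord Coord).hasFDerivAt.comp_hasDerivAt s (hz s hs)
  have h2 : ∀ s ∈ J, HasDerivAt (deriv fun s => (z s).1) (geodesicField M a (z s)).2 s :=
    fun s hs => by
      have := (ContinuousLinearMap.snd ℝ Coord Coord).hasFDerivAt.comp_hasDerivAt s (hz s hs)
      refine this.congr_of_eventuallyEq ?_
      filter_upwards [hJ.mem_nhds hs] with t ht using (h1 t ht).deriv
  refine ⟨fun s hs => ⟨hd s hs, (h1 s hs).differentiableAt, (h2 s hs).differentiableAt,
    fun w => ?_⟩, fun s hs => (h1 s hs).deriv⟩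
  rw [(h2 s hs).deriv, (h1 s hs).deriv, ← christoffelForm_apply h (hd s hs), geodesicField]
  simp only
  rw [map_neg, neg_apply]
  have : metric M a (z s).1 ((metric M a (z s).1).inverse
      (christoffelForm M a (z s).1 (z s).2)) = christoffelForm M a (z s).1 (z s).2 :=
    (metric_isInvertible h (hd s hs)).self_apply_inverse _
  rw [this]
  ring

lemma rad_euler (x : Coord) : rad (euler x) = rad x := rfl

lemma euler_add (x : Coord) : euler x + x 0 • stat = x := by
  ext i; fin_cases i <;> simp

lemma metric_add_stat (x : Coord) (c : ℝ) : metric M a (x + c • stat) = metric M a x := by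
  simp [metric, dr, sinSqDphi, rhoSq, Delta, rad]

lemma fderiv_metric_add_stat (x : Coord) (c : ℝ) :
    fderiv ℝ (metric M a) (x + c • stat) = fderiv ℝ (metric M a) x := by
  rw [← fderiv_comp_add_right]
  simp only [metric_add_stat]

/-- By stationarity the field may be evaluated at `t = 0`. This allows compactness in the quotient
by `∂ₜ` to replace compactness in `K`, where `t` is unbounded. -/
lemma geodesicField_euler (z : Coord × Coord) :
    geodesicField M a (euler z.1, z.2) = geodesicField M a z := by
  have h1 := metric_add_stat (M := M) (a := a) (euler z.1) (z.1 0)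
  have h2 := fderiv_metric_add_stat (M := M) (a := a) (euler z.1) (z.1 0)
  rw [euler_add] at h1 h2
  simp only [geodesicField, christoffelForm, h1, h2]

/-- Null vectors are controlled by their time component. -/
lemma norm_le_of_null (h : |a| < M) {x : Coord} (hx : x ∈ doc M a) {v : Coord}
    (hn : metric M a x v v = 0) : ‖v‖ ≤ |v 0| := by
  have hr := rad_pos h hx
  have hρ := rhoSq_pos h hx
  have hD := Delta_pos h hx
  have hm := massFn_pos h hx
  have hM := mass_pos h
  have hrρ := rad_sq_le_rhoSq (a := a) x
  have hcs := sub_nonneg.2 (dr_sq_le hr v)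
  rw [null_iff] at hn
  have hDr : Delta M a x ≤ rhoSq a x := by
    refine le_trans ?_ hrρ
    have := lt_rad x hx
    have := sq_lt_mass_sq h
    rw [Delta]; nlinarith
  have h1 : 1 ≤ rhoSq a x / rad x ^ 2 := (one_le_div (by positivity)).2 hrρ
  have h2 : 1 ≤ rhoSq a x / Delta M a x := (one_le_div hD).2 hDr
  have h3 : spatialDot v v ≤ v 0 ^ 2 := by
    have e1 := mul_le_mul_of_nonneg_right h1 hcs
    have e2 := mul_le_mul_of_nonneg_right h2 (sq_nonneg (dr x v))
    have e3 : 0 ≤ massFn M a x * tau a x v ^ 2 := by positivity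
    have e4 : 0 ≤ a ^ 2 * sinSqDphi x v ^ 2 := by positivity
    linarith
  rw [pi_norm_le_iff_of_nonneg (abs_nonneg _)]
  intro i
  rw [Real.norm_eq_abs]
  refine sq_le_sq.1 ?_
  rw [spatialDot] at h3
  fin_cases i <;> simp only [Fin.zero_eta, Fin.mk_one, Fin.reduceFinMk] <;>
    nlinarith [sq_nonneg (v 1), sq_nonneg (v 2), sq_nonneg (v 3)]

lemma massFn_le_two (h : |a| < M) {x : Coord} (hx : x ∈ doc M a) : massFn M a x ≤ 2 := by
  have hr := rad_pos h hx
  rw [massFn, div_le_iff₀ (rhoSq_pos h hx)]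
  nlinarith [rad_sq_le_rhoSq (a := a) x, lt_rad x hx]

/-- The slice `t = 0`. -/
def slice (c : Fin 3 → ℝ) : Coord := ![0, c 0, c 1, c 2]

lemma continuous_slice : Continuous slice := by
  refine continuous_pi fun i => ?_
  fin_cases i
  · exact continuous_const
  · exact continuous_apply 0
  · exact continuous_apply 1
  · exact continuous_apply 2

lemma slice_stationaryProj (x : Coord) : slice (stationaryProj x) = euler x := by
  ext i; fin_cases i <;> rfl

lemma slice_mem_doc {c : Fin 3 → ℝ} (hc : c ∈ stationaryProj '' doc M a) :
    slice c ∈ doc M a := by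
  obtain ⟨x, hx, rfl⟩ := hc
  rw [slice_stationaryProj]
  exact hx

/-- Trapped photons are complete. -/
lemma exists_complete_geodesic (h : |a| < M) {x p : Coord} (hx : x ∈ doc M a)
    (hn : metric M a x p p = 0) (ht : IsTrapped M a x p) :
    ∃ (γ : ℝ → Coord) (C : Set (Fin 3 → ℝ)), IsCompact C ∧ C ⊆ stationaryProj '' doc M a ∧
      IsGeodesicOn M a γ univ ∧ γ 0 = x ∧ deriv γ 0 = p ∧ ∀ s, stationaryProj (γ s) ∈ C := by
  obtain ⟨C₀, hC₀, hC₀d, htrap⟩ := ht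
  -- The starting point is added by hand: trapping only speaks about geodesics already known to
  -- exist, while the construction needs the initial data in the compact set.
  set C := insert (stationaryProj x) C₀
  have hC : IsCompact C := hC₀.insert _
  have hCd : C ⊆ stationaryProj '' doc M a := insert_subset (mem_image_of_mem _ hx) hC₀d
  set E := energy M a x p with hE
  set L := angMom M a x p with hL
  have hT : ContinuousOn (fun y : Coord => ((rad y ^ 2 + a ^ 2) * E - a * L) / Delta M a y)
      (slice '' C) := by
    refine ContinuousOn.div ?_ ?_ ?_
    · exact (((continuous_rad.pow 2).add continuous_const).mul continuous_const).sub
        continuous_const |>.continuousOn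
    · exact (((continuous_rad.pow 2).sub (continuous_const.mul continuous_rad)).add
        continuous_const).continuousOn
    · rintro _ ⟨c, hc, rfl⟩
      exact (Delta_pos h (slice_mem_doc (hCd hc))).ne'
  obtain ⟨B, hB⟩ := (hC.image continuous_slice).exists_bound_of_continuousOn hT
  -- The conserved `E` and `L` bound the velocity: a null vector has `‖v‖ ≤ |v⁰|`, and `v⁰ = E +
  -- (2Mr/ρ²) τ`, where `2Mr/ρ² ≤ 2` and `τ = X/Δ` is bounded by `B` over `C`.
  have hbound : ∀ y v, y ∈ doc M a → stationaryProj y ∈ C → metric M a y v v = 0 →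
      energy M a y v = E → angMom M a y v = L → ‖v‖ ≤ |E| + 2 * B := by
    intro y v hy hyC hnv hEv hLv
    have h1 := hB (euler y) ⟨_, hyC, slice_stationaryProj y⟩
    change ‖((rad y ^ 2 + a ^ 2) * E - a * L) / Delta M a y‖ ≤ B at h1
    have h2 := principal_eq h hy v
    rw [hEv, hLv] at h2
    rw [h2, mul_div_cancel_left₀ _ (Delta_pos h hy).ne', Real.norm_eq_abs] at h1
    have h3 : v 0 = E + massFn M a y * tau a y v := by rw [← hEv, energy_eq]; ring
    refine (norm_le_of_null h hy hnv).trans ?_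
    rw [h3]
    refine (abs_add_le _ _).trans ?_
    rw [abs_mul, abs_of_pos (massFn_pos h hy)]
    gcongr
    exact massFn_le_two h hy
  set N : Set (Coord × Coord) :=
    (fun q : (Fin 3 → ℝ) × Coord => (slice q.1, q.2)) '' (C ×ˢ Metric.closedBall 0 (|E| + 2 * B))
  have hN : IsCompact N := (hC.prod (isCompact_closedBall _ _)).image
    ((continuous_slice.comp continuous_fst).prodMk continuous_snd)
  have hNd : N ⊆ tangentBundle M a := by
    rintro _ ⟨q, hq, rfl⟩
    exact slice_mem_doc (hCd hq.1)
  have hmemN : ∀ y v, stationaryProj y ∈ C → ‖v‖ ≤ |E| + 2 * B → (euler y, v) ∈ N :=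
    fun y v hy hv => ⟨(stationaryProj y, v), ⟨hy, mem_closedBall_zero_iff.2 hv⟩, by
      simp only [slice_stationaryProj]⟩
  set P : Coord × Coord →L[ℝ] Coord × Coord :=
    (euler.comp (ContinuousLinearMap.fst ℝ Coord Coord)).prod (ContinuousLinearMap.snd ℝ Coord Coord)
  have hP : ∀ z, P z = (euler z.1, z.2) := fun z => rfl
  obtain ⟨z, V, hV, hNV, hVd, hzc, hz0, hz⟩ := exists_integralCurve_near_compact
    isOpen_tangentBundle hN hNd (f := geodesicField M a)
    (fun z hz => ((contDiffAt_geodesicField h hz).of_le (by simp)).contDiffWithinAt) P (x, p)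
  simp only [hP, geodesicField_euler] at hz
  set O : Set ℝ := (fun s => P (z s)) ⁻¹' V
  have hO : IsOpen O := hV.preimage (P.continuous.comp hzc)
  have h0O : (0 : ℝ) ∈ O := by
    refine hNV ?_
    change P (z 0) ∈ N
    rw [hz0]
    exact hmemN x p (mem_insert _ _) (hbound x p hx (mem_insert _ _) hn rfl rfl)
  set J := connectedComponentIn O 0
  have hJ : IsOpen J := hO.connectedComponentIn
  have hJO : J ⊆ O := connectedComponentIn_subset O 0
  have hJ0 : (0 : ℝ) ∈ J := mem_connectedComponentIn h0O
  have hJc : J.OrdConnected := isPreconnected_connectedComponentIn.ordConnected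
  obtain ⟨hγ, hγd⟩ := isGeodesicOn_of_integralCurve h (z := z) hJ
    (fun s hs => (hVd (hJO hs) : P (z s) ∈ tangentBundle M a)) (fun s hs => hz s (hJO hs))
  have hγ0 : (z 0).1 = x := by rw [hz0]
  have hγ1 : deriv (fun s => (z s).1) 0 = p := by rw [hγd 0 hJ0, hz0]
  have hin : ∀ s ∈ J, stationaryProj (z s).1 ∈ C := fun s hs =>
    mem_insert_of_mem _ (htrap _ J hJ hJc hJ0 hγ hγ0 hγ1 s hs)
  obtain ⟨K, hK⟩ := hγ.exists_carter h hJ hJc hJ0 (by rwa [hγ1, hγ0])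
  have hJN : ∀ s ∈ J, P (z s) ∈ N := fun s hs => by
    obtain ⟨k1, k2, k3, -⟩ := hK s hs
    rw [hγ1, hγ0] at k2 k3
    rw [hγd s hs] at k1 k2 k3
    exact hmemN _ _ (hin s hs) (hbound _ _ (hγ s hs).1 (hin s hs) k1 k2 k3)
  -- On `J` the curve stays, modulo time translation, in the closed set `N`, hence so on its
  -- closure. As `N ⊆ V`, the closure lies in `O` and thus in the component `J`, which is therefore
  -- open and closed in `ℝ`.
  have hcl : closure J ⊆ J := by
    refine isPreconnected_connectedComponentIn.closure.subset_connectedComponentIn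
      (subset_closure hJ0) fun s hs => hNV ?_
    exact closure_minimal hJN (hN.isClosed.preimage (P.continuous.comp hzc)) hs
  have hJu : J = univ :=
    IsClopen.eq_univ ⟨closure_subset_iff_isClosed.1 hcl, hJ⟩ ⟨0, hJ0⟩
  rw [hJu] at hγ hin
  exact ⟨_, C, hC, hCd, hγ, hγ0, hγ1, fun s => hin s trivial⟩

/-- Completeness and compactness confine `r` to a closed interval beyond the horizon for all
parameters, so `r` is constant. The radial equation with `r' = 0` then reads `τ · criticalFn = 0`,
and `τ ≠ 0`. -/
lemma photonRegion_subset (h : |a| < M) : photonRegion M a ⊆ sphericalPhotons M a := by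
  rintro ⟨x, p⟩ ⟨hx, hn, hp, ht⟩
  change x ∈ doc M a at hx
  simp only at hn hp ht
  obtain ⟨γ, C, hC, hCd, hγ, hγ0, hγ1, hin⟩ := exists_complete_geodesic h hx hn ht
  obtain ⟨K, hK⟩ := hγ.exists_carter h isOpen_univ ordConnected_univ trivial (by rwa [hγ0, hγ1])
  rw [hγ0, hγ1] at hK
  set E := energy M a x p with hE
  set L := angMom M a x p with hL
  have hp0 : p ≠ 0 := by rintro rfl; simp at hp
  have hτ : tau a x p ≠ 0 := fun h0 => hp0 (eq_zero_of_null_of_tau h hx hn h0)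
  have hΔ := Delta_pos h hx
  have hX0 : (rad x ^ 2 + a ^ 2) * E - a * L ≠ 0 := by
    rw [principal_eq h hx]; exact mul_ne_zero hΔ.ne' hτ
  have hd : ∀ s, γ s ∈ doc M a := fun s => (hγ s trivial).1
  -- A zero of `X` along the orbit would make the velocity vanish there, hence `E = L = 0`,
  -- contradicting `X ≠ 0` at the start.
  have hX : ∀ s, (rad (γ s) ^ 2 + a ^ 2) * E - a * L ≠ 0 := fun s h0 => by
    obtain ⟨k1, k2, k3, -⟩ := hK s trivial
    have e := principal_eq h (hd s) (deriv γ s)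
    rw [k2, k3, h0] at e
    have hv := eq_zero_of_null_of_tau h (hd s) k1
      ((mul_eq_zero.1 e.symm).resolve_left (Delta_pos h (hd s)).ne')
    rw [hv] at k2 k3
    have e2 : E = 0 := by rw [← k2, energy]; simp
    have e3 : L = 0 := by rw [← k3, angMom]; simp
    rw [e2, e3] at hX0
    simp at hX0
  have hne : C.Nonempty := ⟨_, hin 0⟩
  have hcont : ContinuousOn (fun c => rad (slice c)) C :=
    (continuous_rad.comp continuous_slice).continuousOn
  obtain ⟨c₁, hc₁, hmin⟩ := hC.exists_isMinOn hne hcont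
  obtain ⟨c₂, hc₂, hmax⟩ := hC.exists_isMaxOn hne hcont
  have hsl : ∀ s, rad (slice (stationaryProj (γ s))) = rad (γ s) := fun s => by
    rw [slice_stationaryProj, rad_euler]
  have hr₁ : ∀ s, rad (slice c₁) ≤ rad (γ s) := fun s => hsl s ▸ hmin (hin s)
  have hr₂ : ∀ s, rad (γ s) ≤ rad (slice c₂) := fun s => hsl s ▸ hmax (hin s)
  have hr : ∀ s, HasDerivAt (fun s => rad (γ s)) (dr (γ s) (deriv γ s)) s :=
    fun s => hγ.hasDerivAt_rad h trivial
  have hconst := eq_of_radial_bounded h (B := (rad (slice c₂) ^ 2 + a ^ 2) ^ 2) hr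
    (fun s => (hK s trivial).2.2.2) (fun s => by
      have h1 := rad_pos h (hd s)
      refine pow_le_pow_left₀ (rhoSq_pos h (hd s)).le ((rhoSq_le h1).trans ?_) 2
      gcongr
      exact hr₂ s) hX (slice_mem_doc (hCd hc₁)) hr₁ hr₂
  have hdr : ∀ s, dr (γ s) (deriv γ s) = 0 := fun s => by
    have : (fun s => rad (γ s)) = fun _ => rad (γ 0) := funext fun s => hconst s 0
    have h1 := hr s
    rw [this] at h1
    exact h1.unique (hasDerivAt_const s _)
  have hu := hγ.hasDerivAt_radial h isOpen_univ (s := 0) trivial (by rwa [hγ0, hγ1])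
  simp only [hdr, mul_zero] at hu
  have h1 := hu.unique (hasDerivAt_const (0 : ℝ) (0 : ℝ))
  rw [hγ0, hγ1, div_eq_zero_iff, or_iff_left (rhoSq_pos h hx).ne'] at h1
  have hdr0 := hdr 0
  rw [hγ0, hγ1] at hdr0
  refine ⟨hx, hn, hp, hdr0, ?_⟩
  simp only [criticalFn]
  rw [principal_eq h hx]
  refine (mul_eq_zero.1 (?_ : tau a x p * _ = 0)).resolve_left hτ
  rw [Delta] at h1 ⊢
  linear_combination h1

theorem photonRegion_eq (h : |a| < M) : photonRegion M a = sphericalPhotons M a :=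
  (photonRegion_subset h).antisymm (sphericalPhotons_subset h)

/-! ### The regular value theorem -/

/-- Regular level sets are smooth embedded submanifolds. -/
lemma isSmoothSubmanifold_of_regular {E G : Type*} [NormedAddCommGroup E] [NormedSpace ℝ E]
    [FiniteDimensional ℝ E] [NormedAddCommGroup G] [NormedSpace ℝ G] [FiniteDimensional ℝ G]
    {k : ℕ} (hk : Module.finrank ℝ E = Module.finrank ℝ G + k) {U O S : Set E} {F : E → G}
    (hO : IsOpen O) (hOU : O ⊆ U) (hS : S = {y | y ∈ O ∧ F y = 0})
    (hF : ∀ y ∈ O, ContDiffAt ℝ ∞ F y)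
    (hsurj : ∀ z ∈ S, Function.Surjective (fderiv ℝ F z)) : IsSmoothSubmanifold k U S := by
  have := FiniteDimensional.complete ℝ E
  have hmem : ∀ {y}, y ∈ S ↔ y ∈ O ∧ F y = 0 := fun {y} => by rw [hS]; rfl
  refine ⟨fun y hy => hOU (hmem.1 hy).1, fun z hz => ?_⟩
  set A := fderiv ℝ F z with hA
  obtain ⟨B₀, hB₀⟩ := A.toLinearMap.exists_rightInverse_of_surjective
    (LinearMap.range_eq_top.2 (hsurj z hz))
  set B : G →L[ℝ] E := LinearMap.toContinuousLinearMap B₀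
  have hAB : ∀ y, A (B y) = y := fun y => LinearMap.congr_fun hB₀ y
  -- With `B` a right inverse of `A`, this map has derivative the identity at `z` and satisfies `A ∘
  -- e₀ = F`, so it carries `F = 0` to the linear slice `ker A`.
  set e₀ : E → E := fun y => y - B (A y) + B (F y) with he₀
  have hAe : ∀ y, A (e₀ y) = F y := fun y => by simp [e₀, hAB]
  have hzO := (hmem.1 hz).1
  have hsm : ∀ y ∈ O, ContDiffAt ℝ ∞ e₀ y := fun y hy =>
    (contDiffAt_id.sub (B.contDiff.comp A.contDiff).contDiffAt).add
      (B.contDiff.contDiffAt.comp y (hF y hy))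
  have hd : HasFDerivAt e₀ ((ContinuousLinearEquiv.refl ℝ E : E ≃L[ℝ] E) : E →L[ℝ] E) z := by
    have h1 : HasFDerivAt F A z := ((hF z hzO).differentiableAt (by simp)).hasFDerivAt
    refine (((hasFDerivAt_id z).sub (B.hasFDerivAt.comp z A.hasFDerivAt)).add
      (B.hasFDerivAt.comp z h1)).congr_fderiv ?_
    ext y
    simp
  set φ := (hsm z hzO).toOpenPartialHomeomorph e₀ hd (by simp) with hφ
  have hφe : ∀ y, φ y = e₀ y := fun y => rfl
  have hcont : ContinuousOn (fderiv ℝ e₀) O := fun y hy =>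
    (((hsm y hy).fderiv_right (m := 0) (by simp)).continuousAt).continuousWithinAt
  -- Restricting to points where the derivative is invertible makes the inverse chart smooth on its
  -- whole target.
  set O' := O ∩ fderiv ℝ e₀ ⁻¹' range ((↑) : (E ≃L[ℝ] E) → E →L[ℝ] E)
  have hO' : IsOpen O' := hcont.isOpen_inter_preimage hO ContinuousLinearEquiv.isOpen
  have hsrc : (φ.restrOpen O' hO').source = φ.source ∩ O' := φ.restrOpen_source O' hO'
  refine ⟨φ.restrOpen O' hO', LinearMap.ker A.toLinearMap, ?_, ?_, ?_, ?_, ?_, ?_⟩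
  · rw [hsrc]
    exact ⟨(hsm z hzO).mem_toOpenPartialHomeomorph_source hd (by simp), hzO, ⟨_, hd.fderiv.symm⟩⟩
  · rw [hsrc]
    exact fun y hy => hOU hy.2.1
  · rw [hsrc]
    exact fun y hy => (hsm y hy.2.1).contDiffWithinAt
  · intro w hw
    have hy := (φ.restrOpen O' hO').map_target hw
    rw [hsrc] at hy
    obtain ⟨f', hf'⟩ := hy.2.2
    refine ((φ.restrOpen O' hO').contDiffAt_symm hw (f₀' := f') ?_ ?_).contDiffWithinAt
    · rw [hf']
      exact ((hsm _ hy.2.1).differentiableAt (by simp)).hasFDerivAt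
    · exact hsm _ hy.2.1
  · have h1 := A.toLinearMap.finrank_range_add_finrank_ker
    rw [LinearMap.range_eq_top.2 (hsurj z hz), finrank_top, hk] at h1
    exact Nat.add_left_cancel h1
  · ext w
    constructor
    · rintro ⟨y, ⟨hyS, hy⟩, rfl⟩
      refine ⟨(φ.restrOpen O' hO').map_source hy, ?_⟩
      change A (e₀ y) = 0
      rw [hAe]
      exact (hmem.1 hyS).2
    · rintro ⟨hw, hwA⟩
      have hy := (φ.restrOpen O' hO').map_target hw
      have hyw := (φ.restrOpen O' hO').right_inv hw
      refine ⟨_, ⟨hmem.2 ⟨?_, ?_⟩, hy⟩, hyw⟩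
      · rw [hsrc] at hy
        exact hy.2.1
      · rw [← hAe]
        change A ((φ.restrOpen O' hO') _) = 0
        rw [hyw]
        exact hwA

/-! ### Independence of the defining equations -/

/-- The defining functions of the photon region. -/
def photonFn (M a : ℝ) (z : Coord × Coord) : ℝ × ℝ × ℝ :=
  (metric M a z.1 z.2 z.2, dr z.1 z.2,
    criticalFn M a (energy M a z.1 z.2) (angMom M a z.1 z.2) (rad z.1))

/-- The tangent vectors with positive time component. -/
def futureBundle (M a : ℝ) : Set (Coord × Coord) := {z | z.1 ∈ doc M a ∧ 0 < z.2 0}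

lemma isOpen_futureBundle : IsOpen (futureBundle M a) :=
  (isOpen_doc.preimage continuous_fst).inter 
    (isOpen_lt continuous_const ((continuous_apply (0 : Fin 4)).comp continuous_snd))

lemma sphericalPhotons_eq :
    sphericalPhotons M a = {z | z ∈ futureBundle M a ∧ photonFn M a z = 0} := by
  ext z
  simp only [sphericalPhotons, futureBundle, photonFn, mem_ofPred_eq, Prod.mk_eq_zero]
  tauto

lemma contDiffAt_photonFn (h : |a| < M) {z : Coord × Coord} (hz : z.1 ∈ doc M a) :
    ContDiffAt ℝ ∞ (photonFn M a) z := by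
  have hg := contDiffAt_metric_fst h hz
  have hv : ContDiffAt ℝ ∞ (fun z : Coord × Coord => z.2) z := contDiffAt_snd
  have hr : ContDiffAt ℝ ∞ (fun z : Coord × Coord => rad z.1) z :=
    (contDiffAt_rad (rad_pos h hz)).comp z contDiffAt_fst
  have hdr : ContDiffAt ℝ ∞ (fun z : Coord × Coord => dr z.1) z :=
    (contDiffAt_dr (rad_pos h hz)).comp z contDiffAt_fst
  have hE : ContDiffAt ℝ ∞ (fun z : Coord × Coord => energy M a z.1 z.2) z :=
    ((hg.clm_apply hv).clm_apply contDiffAt_const).neg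
  have hL : ContDiffAt ℝ ∞ (fun z : Coord × Coord => angMom M a z.1 z.2) z :=
    (hg.clm_apply hv).clm_apply (axial.contDiff.contDiffAt.comp z contDiffAt_fst)
  refine ((hg.clm_apply hv).clm_apply hv).prodMk ((hdr.clm_apply hv).prodMk ?_)
  unfold criticalFn
  fun_prop

/-- `X = Δ τ` is nonzero because the photon's velocity is. With `E = 0`, criticality would read `(r
- M) X = 0`, although `r > M`. -/
lemma energy_ne_zero (h : |a| < M) {z : Coord × Coord} (hz : z ∈ sphericalPhotons M a) :
    energy M a z.1 z.2 ≠ 0 ∧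
      (rad z.1 ^ 2 + a ^ 2) * energy M a z.1 z.2 - a * angMom M a z.1 z.2 ≠ 0 := by
  obtain ⟨hx, hn, hp, hdr, hq⟩ := hz
  have hX : (rad z.1 ^ 2 + a ^ 2) * energy M a z.1 z.2 - a * angMom M a z.1 z.2 ≠ 0 := by
    rw [principal_eq h hx]
    refine mul_ne_zero (Delta_pos h hx).ne' fun h0 => ?_
    rw [eq_zero_of_null_of_tau h hx hn h0] at hp
    simp at hp
  refine ⟨fun hE => hX ?_, hX⟩
  rw [criticalFn, hE] at hq
  have hk : rad z.1 - M ≠ 0 := (sub_pos.2 (lt_rad _ hx)).ne'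
  refine (mul_eq_zero.1 (?_ : (rad z.1 - M) * _ = 0)).resolve_left hk
  rw [hE]
  linarith

/-- The radial derivative of `criticalFn` does not vanish at its zeros. -/
lemma deriv_criticalFn_ne_zero (h : |a| < M) {E L r : ℝ} (hr : M + √(M ^ 2 - a ^ 2) < r)
    (hq : criticalFn M a E L r = 0) (hE : E ≠ 0) :
    2 * E * (r ^ 2 - 2 * M * r + a ^ 2) + 2 * r * E * (r - M)
      - ((r ^ 2 + a ^ 2) * E - a * L) ≠ 0 := by
  intro h0
  have hD := horizon_pos h hr
  have hM := mass_pos h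
  have ha := sq_lt_mass_sq h
  have hk : 0 < r - M := by
    have := Real.sqrt_nonneg (M ^ 2 - a ^ 2)
    linarith
  have hpos : 0 < (r ^ 2 - 2 * M * r + a ^ 2) * (r - M) + r * (M ^ 2 - a ^ 2) :=
    add_pos (mul_pos hD hk) (mul_pos (by linarith) (by linarith))
  -- Eliminating `X` between the function and its derivative leaves `2 E` times a positive number,
  -- since `(r - M)² - Δ = M² - a²`.
  have : 2 * E * ((r ^ 2 - 2 * M * r + a ^ 2) * (r - M) + r * (M ^ 2 - a ^ 2)) = 0 := by
    rw [criticalFn] at hq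
    linear_combination (r - M) * h0 - hq
  exact mul_ne_zero (mul_ne_zero two_ne_zero hE) hpos.ne' this

/-- At a spherical photon the Lie derivative of the metric along the Euler field vanishes. -/
lemma lieDeriv_euler_eq_zero (h : |a| < M) {z : Coord × Coord} (hz : z ∈ sphericalPhotons M a) :
    metricDeriv M a z.1 (euler z.1) z.2 z.2 + 2 * metric M a z.1 z.2 (euler z.2) = 0 := by
  obtain ⟨hx, hn, hp, hdr, hq⟩ := hz
  have hr := rad_pos h hx
  have hρ := rhoSq_pos h hx
  have hD := Delta_pos h hx
  rw [metricDeriv_euler h hx, hdr]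
  rw [null_iff, hdr] at hn
  rw [criticalFn, principal_eq h hx, energy_eq] at hq
  -- Criticality divided by `Δ`, using `X = Δ τ`. Geometrically, the claim is the vanishing rate of
  -- change of `g(γ', r ∂_r)` on an orbit of constant radius; here it follows from criticality and
  -- nullity alone.
  have hq' : 2 * rad z.1 * (z.2 0 - massFn M a z.1 * tau a z.1 z.2)
      = (rad z.1 - M) * tau a z.1 z.2 := by
    refine mul_left_cancel₀ hD.ne' ?_
    rw [Delta] at hq ⊢
    linear_combination hq
  have ht : a * sinSqDphi z.1 z.2 = z.2 0 - tau a z.1 z.2 := by rw [tau_apply]; ring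
  have hS : rhoSq a z.1 * spatialDot z.2 z.2 = rad z.1 ^ 2 * (2 * z.2 0 * tau a z.1 z.2
      - (1 + massFn M a z.1) * tau a z.1 z.2 ^ 2) := by
    have e : a ^ 2 * sinSqDphi z.1 z.2 ^ 2 = (z.2 0 - tau a z.1 z.2) ^ 2 := by rw [← ht]; ring
    rw [e] at hn
    field_simp at hn
    refine mul_left_cancel₀ hD.ne' ?_
    linear_combination hn
  have hm : rhoSq a z.1 * massFn M a z.1 = 2 * M * rad z.1 := by unfold massFn; field_simp
  refine (mul_eq_zero.1 (?_ : rhoSq a z.1 * _ = 0)).resolve_left hρ.ne'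
  have e3 : rhoSq a z.1 * (2 * rad z.1 ^ 2 / rhoSq a z.1) = 2 * rad z.1 ^ 2 := by field_simp
  linear_combination 2 * hS + tau a z.1 z.2 ^ 2 * hm + 2 * rad z.1 * tau a z.1 z.2 * hq'
    - massFn M a z.1 * tau a z.1 z.2 ^ 2 * e3

/-- Back-substitution: the first component fixes the coefficient of `d₁`, the third that of `d₃`,
the second that of `d₂`. -/
lemma surjective_of_triangular {E : Type*} [AddCommGroup E] [Module ℝ E]
    [TopologicalSpace E] (A : E →L[ℝ] ℝ × ℝ × ℝ) {d₁ d₂ d₃ : E} (h₁ : (A d₁).1 ≠ 0)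
    (h₂₁ : (A d₂).1 = 0) (h₂₂ : (A d₂).2.1 ≠ 0) (h₂₃ : (A d₂).2.2 = 0)
    (h₃₁ : (A d₃).1 = 0) (h₃₃ : (A d₃).2.2 ≠ 0) : Function.Surjective A := by
  rintro ⟨p, q, s⟩
  set α := p / (A d₁).1
  set β := (s - α * (A d₁).2.2) / (A d₃).2.2
  set δ := (q - α * (A d₁).2.1 - β * (A d₃).2.1) / (A d₂).2.1
  have e1 : α * (A d₁).1 = p := div_mul_cancel₀ _ h₁
  have e2 : β * (A d₃).2.2 = s - α * (A d₁).2.2 := div_mul_cancel₀ _ h₃₃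
  have e3 : δ * (A d₂).2.1 = q - α * (A d₁).2.1 - β * (A d₃).2.1 := div_mul_cancel₀ _ h₂₂
  refine ⟨α • d₁ + β • d₃ + δ • d₂, ?_⟩
  simp only [map_add, map_smul]
  refine Prod.ext ?_ (Prod.ext ?_ ?_)
  · simp only [Prod.fst_add, Prod.smul_fst, smul_eq_mul, h₂₁, h₃₁]; linarith
  · simp only [Prod.fst_add, Prod.snd_add, Prod.smul_fst, Prod.smul_snd, smul_eq_mul]; linarith
  · simp only [Prod.snd_add, Prod.smul_snd, smul_eq_mul, h₂₃]; linarith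

/-- Three directions give a triangular system. Moving `v` along `∂ₜ` changes `g(v, v)` at rate `-2E
≠ 0`. Moving `v` along `r ∂_r` changes `dr(v)` but, as `dr(v) = 0`, neither `g(v, v)` to first order
nor `E` and `L`. The third direction moves `x` radially and corrects `v` so that `E`, `L` and `g(v,
v)` stay fixed to first order. -/
lemma surjective_fderiv_photonFn (h : |a| < M) {z : Coord × Coord}
    (hz : z ∈ sphericalPhotons M a) : Function.Surjective (fderiv ℝ (photonFn M a) z) := by
  obtain ⟨hE, hX⟩ := energy_ne_zero h hz
  have hlie := lieDeriv_euler_eq_zero h hz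
  obtain ⟨x, v⟩ := z
  obtain ⟨hx, hn, hp, hdr, hq⟩ := hz
  simp only at hx hn hp hdr hq hE hX hlie
  have hr := rad_pos h hx
  have hF : HasFDerivAt (photonFn M a) (fderiv ℝ (photonFn M a) (x, v)) (x, v) :=
    ((contDiffAt_photonFn h hx).differentiableAt (by simp)).hasFDerivAt
  have hcurve : ∀ u w : Coord, HasDerivAt (fun l : ℝ => photonFn M a (x + l • u, v + l • w))
      (fderiv ℝ (photonFn M a) (x, v) (u, w)) 0 := fun u w => by
    refine HasFDerivAt.comp_hasDerivAt_of_eq (0 : ℝ) hF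
      ((hasDerivAt_line x u).prodMk (hasDerivAt_line v w)) (by simp)
  have hfst : ∀ u w : Coord, HasDerivAt
      (fun l : ℝ => metric M a (x + l • u) (v + l • w) (v + l • w))
      (fderiv ℝ (photonFn M a) (x, v) (u, w)).1 0 := fun u w =>
    (ContinuousLinearMap.fst ℝ ℝ (ℝ × ℝ)).hasFDerivAt.comp_hasDerivAt 0 (hcurve u w)
  have hsnd : ∀ u w : Coord, HasDerivAt (fun l : ℝ => dr (x + l • u) (v + l • w))
      (fderiv ℝ (photonFn M a) (x, v) (u, w)).2.1 0 := fun u w =>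
    ((ContinuousLinearMap.fst ℝ ℝ ℝ).comp
      (ContinuousLinearMap.snd ℝ ℝ (ℝ × ℝ))).hasFDerivAt.comp_hasDerivAt 0 (hcurve u w)
  have hthd : ∀ u w : Coord, HasDerivAt (fun l : ℝ => criticalFn M a
      (energy M a (x + l • u) (v + l • w)) (angMom M a (x + l • u) (v + l • w)) (rad (x + l • u)))
      (fderiv ℝ (photonFn M a) (x, v) (u, w)).2.2 0 := fun u w =>
    ((ContinuousLinearMap.snd ℝ ℝ ℝ).comp
      (ContinuousLinearMap.snd ℝ ℝ (ℝ × ℝ))).hasFDerivAt.comp_hasDerivAt 0 (hcurve u w)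
  have hmet : ∀ u w : Coord, (fderiv ℝ (photonFn M a) (x, v) (u, w)).1
      = metricDeriv M a x u v v + 2 * metric M a x v w := fun u w => by
    have h1 := hasDerivAt_metric (M := M) (a := a) h (by simpa using hx) (hasDerivAt_line x u)
      (hasDerivAt_line v w) (hasDerivAt_line v w)
    refine (hfst u w).unique h1 |>.trans ?_
    simp only [zero_smul, add_zero]
    rw [metric_symm x w v]
    ring
  have hdz : ∀ v w, metricDeriv M a x 0 v w = 0 := fun v w => by simp [metricDeriv]
  -- `β` is the Lie derivative of `g` along the Euler field, contracted with `v`. The correction `η`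
  -- below cancels it, so `g(v, w)` is stationary whenever `w` is carried along by the Euler flow.
  -- This applies to `∂ₜ` and `∂_φ`, which commute with that flow, and also to `v` because `β(v) =
  -- 0`.
  set β : Coord →L[ℝ] ℝ := fderiv ℝ (metric M a) x (euler x) v + metric M a x (euler v)
    + (metric M a x v).comp euler with hβ
  have hβa : ∀ w, β w = metricDeriv M a x (euler x) v w + metric M a x (euler v) w
      + metric M a x v (euler w) := fun w => by rw [metricDeriv_eq h hx]; rfl
  set η : Coord := -(metric M a x).inverse β
  have hη : ∀ w, metric M a x η w = -β w := fun w => by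
    have := (metric_isInvertible h hx).self_apply_inverse β
    rw [map_neg, this]; rfl
  have hβv : β v = 0 := by
    rw [hβa, metric_symm x (euler v) v]
    linarith
  refine surjective_of_triangular _ (d₁ := (0, stat)) (d₂ := (0, euler x))
    (d₃ := (euler x, euler v + η)) ?_ ?_ ?_ ?_ ?_ ?_
  · rw [hmet, hdz]
    simpa [energy] using hE
  · rw [hmet, hdz, metric_euler h hx, hdr]
    simp
  · have h1 := hsnd 0 (euler x)
    simp only [smul_zero, add_zero, map_add, map_smul, smul_eq_mul] at h1
    have h2 := ((hasDerivAt_id (0 : ℝ)).mul_const (dr x (euler x))).const_add (dr x v)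
    rw [h1.unique h2, dr_euler hr]
    simpa using hr.ne'
  · have h1 := hthd 0 (euler x)
    have e1 : ∀ l : ℝ, energy M a x (v + l • euler x) = energy M a x v := fun l => by
      have : metric M a x (euler x) stat = 0 := by
        rw [metric_symm, metric_euler h hx, dr_apply]; simp [spatialDot]
      simp [energy, this]
    have e2 : ∀ l : ℝ, angMom M a x (v + l • euler x) = angMom M a x v := fun l => by
      have : metric M a x (euler x) (axial x) = 0 := by
        rw [metric_symm, metric_euler h hx, dr_axial]; simp
      simp [angMom, this]
    simp only [smul_zero, add_zero, e1, e2] at h1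
    exact h1.unique (hasDerivAt_const _ _)
  · rw [hmet, map_add, metric_symm x v η, hη, hβv]
    linarith
  · have hE' : HasDerivAt (fun l : ℝ => energy M a (x + l • euler x) (v + l • (euler v + η))) 0 0 := by
      refine (hasDerivAt_metric (M := M) (a := a) h (by simpa using hx)
        (hasDerivAt_line x (euler x)) (hasDerivAt_line v (euler v + η))
        (hasDerivAt_const (0 : ℝ) stat)).neg.congr_deriv ?_
      have e0 : euler stat = 0 := by ext i; fin_cases i <;> simp
      simp only [zero_smul, add_zero, map_add, add_apply, hη, hβa, e0, map_zero]
      ring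
    have hL' : HasDerivAt (fun l : ℝ => angMom M a (x + l • euler x) (v + l • (euler v + η))) 0 0 := by
      have hax : HasDerivAt (fun l : ℝ => axial (x + l • euler x)) (axial (euler x)) 0 :=
        axial.hasFDerivAt.comp_hasDerivAt 0 (hasDerivAt_line x (euler x))
      refine (hasDerivAt_metric (M := M) (a := a) h (by simpa using hx)
        (hasDerivAt_line x (euler x)) (hasDerivAt_line v (euler v + η)) hax).congr_deriv ?_
      have e0 : axial (euler x) = euler (axial x) := by ext i; fin_cases i <;> simp
      simp only [zero_smul, add_zero, map_add, add_apply, hη, hβa, e0]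
      ring
    have hr' : HasDerivAt (fun l : ℝ => rad (x + l • euler x)) (rad x) 0 := by
      have := HasFDerivAt.comp_hasDerivAt_of_eq (0 : ℝ) (hasFDerivAt_rad hr)
        (hasDerivAt_line x (euler x)) (by simp)
      rwa [dr_euler hr] at this
    have key : HasDerivAt (fun l : ℝ => criticalFn M a
        (energy M a (x + l • euler x) (v + l • (euler v + η)))
        (angMom M a (x + l • euler x) (v + l • (euler v + η))) (rad (x + l • euler x)))
        ((2 * energy M a x v * (rad x ^ 2 - 2 * M * rad x + a ^ 2)
          + 2 * rad x * energy M a x v * (rad x - M)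
          - ((rad x ^ 2 + a ^ 2) * energy M a x v - a * angMom M a x v)) * rad x) 0 := by
      have h2 := hr'.pow 2
      refine HasDerivAt.congr_deriv ((((hr'.const_mul 2).mul hE').mul
        ((h2.sub (hr'.const_mul (2 * M))).add_const (a ^ 2))).sub ((hr'.sub_const M).mul
          (((h2.add_const (a ^ 2)).mul hE').sub (hL'.const_mul a)))) ?_
      simp only [Pi.mul_apply, Pi.sub_apply, Pi.pow_apply, zero_smul, add_zero]
      norm_num
      ring
    rw [(hthd _ _).unique key]
    exact mul_ne_zero (deriv_criticalFn_ne_zero h hx hq hE) hr.ne'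

lemma isSmoothSubmanifold_photonRegion (h : |a| < M) :
    IsSmoothSubmanifold 5 (tangentBundle M a) (photonRegion M a) := by
  rw [photonRegion_eq h]
  exact isSmoothSubmanifold_of_regular (by simp) isOpen_futureBundle (fun z hz => hz.1)
    sphericalPhotons_eq (fun z hz => contDiffAt_photonFn h hz.1)
    fun z hz => surjective_fderiv_photonFn h hz

/-! ### The photon region in the cotangent bundle -/

/-- The inverse of the canonical isomorphism `TK → T*K`. -/
def sharp (M a : ℝ) (w : Coord × (Coord →L[ℝ] ℝ)) : Coord × Coord :=
  (w.1, (metric M a w.1).inverse w.2)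

lemma sharp_flat (h : |a| < M) {z : Coord × Coord} (hz : z.1 ∈ doc M a) :
    sharp M a (flat M a z) = z :=
  Prod.ext rfl ((metric_isInvertible h hz).inverse_apply_self z.2)

lemma flat_sharp (h : |a| < M) {w : Coord × (Coord →L[ℝ] ℝ)} (hw : w.1 ∈ doc M a) :
    flat M a (sharp M a w) = w :=
  Prod.ext rfl ((metric_isInvertible h hw).self_apply_inverse w.2)

lemma contDiffAt_sharp (h : |a| < M) {w : Coord × (Coord →L[ℝ] ℝ)} (hw : w.1 ∈ doc M a) :
    ContDiffAt ℝ ∞ (sharp M a) w := by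
  have h1 : ContDiffAt ℝ ∞ (fun w : Coord × (Coord →L[ℝ] ℝ) => (metric M a w.1).inverse) w :=
    (contDiffAt_metric_inverse h hw).comp w contDiffAt_fst
  exact contDiffAt_fst.prodMk (h1.clm_apply contDiffAt_snd)

lemma contDiffAt_flat (h : |a| < M) {z : Coord × Coord} (hz : z.1 ∈ doc M a) :
    ContDiffAt ℝ ∞ (flat M a) z :=
  contDiffAt_fst.prodMk ((contDiffAt_metric_fst h hz).clm_apply contDiffAt_snd)

lemma cotangentPhotonRegion_eq (h : |a| < M) : cotangentPhotonRegion M a =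
    {w | w ∈ {w | w.1 ∈ doc M a ∧ 0 < (sharp M a w).2 0} ∧ (photonFn M a ∘ sharp M a) w = 0} := by
  rw [cotangentPhotonRegion, photonRegion_eq h, sphericalPhotons_eq]
  ext w
  constructor
  · rintro ⟨z, ⟨⟨hz, hp⟩, h0⟩, rfl⟩
    have e := sharp_flat h hz
    refine ⟨⟨hz, ?_⟩, ?_⟩
    · rw [e]; exact hp
    · rw [Function.comp_apply, e]; exact h0
  · rintro ⟨⟨hw, hp⟩, h0⟩
    exact ⟨sharp M a w, ⟨⟨hw, hp⟩, h0⟩, flat_sharp h hw⟩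

lemma isSmoothSubmanifold_cotangentPhotonRegion (h : |a| < M) :
    IsSmoothSubmanifold 5 (cotangentBundle M a) (cotangentPhotonRegion M a) := by
  have hcomp : ∀ w : Coord × (Coord →L[ℝ] ℝ), w.1 ∈ doc M a →
      ContDiffAt ℝ ∞ (photonFn M a ∘ sharp M a) w := fun w hw =>
    (contDiffAt_photonFn h (z := sharp M a w) hw).comp w (contDiffAt_sharp h hw)
  have hfin : Module.finrank ℝ (Coord →L[ℝ] ℝ) = 4 := by
    rw [← LinearEquiv.finrank_eq (LinearMap.toContinuousLinearMap (𝕜 := ℝ) (E := Coord) (F' := ℝ))]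
    exact (Subspace.dual_finrank_eq (K := ℝ) (V := Coord)).trans (by simp)
  refine isSmoothSubmanifold_of_regular (by simp [hfin]) ?_ (fun w hw => hw.1)
    (cotangentPhotonRegion_eq h) (fun w hw => hcomp w hw.1) ?_
  · have hc : ContinuousOn (fun w => (sharp M a w).2 0) (cotangentBundle M a) := fun w hw =>
      ((continuous_apply (0 : Fin 4)).continuousAt.comp
        (contDiffAt_sharp h hw).continuousAt.snd).continuousWithinAt
    exact hc.isOpen_inter_preimage (isOpen_doc.preimage continuous_fst) isOpen_Ioi
  · rw [cotangentPhotonRegion, photonRegion_eq h]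
    rintro _ ⟨z, hz, rfl⟩
    have hd1 : HasFDerivAt (photonFn M a ∘ sharp M a)
        (fderiv ℝ (photonFn M a ∘ sharp M a) (flat M a z)) (flat M a z) :=
      ((hcomp _ hz.1).differentiableAt (by simp)).hasFDerivAt
    have hd2 : HasFDerivAt (flat M a) (fderiv ℝ (flat M a) z) z :=
      ((contDiffAt_flat h hz.1).differentiableAt (by simp)).hasFDerivAt
    -- Near `z`, `photonFn = (photonFn ∘ sharp) ∘ flat`. By the chain rule, surjectivity of the
    -- composite differential passes to its outer factor.
    have hd3 := (hd1.comp z hd2).congr_of_eventuallyEq (f₁ := photonFn M a) (by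
      filter_upwards [isOpen_tangentBundle.mem_nhds (show z ∈ tangentBundle M a from hz.1)] with y hy
      rw [Function.comp_apply, Function.comp_apply, sharp_flat h hy])
    have hs := surjective_fderiv_photonFn h hz
    rw [hd3.fderiv, ContinuousLinearMap.coe_comp] at hs
    exact hs.of_comp

end Kerr

end

theorem theorem3 (M a : ℝ) (hsub : |a| < M) :
    Kerr.IsSmoothSubmanifold 5 (Kerr.tangentBundle M a) (Kerr.photonRegion M a) ∧
    Kerr.IsSmoothSubmanifold 5 (Kerr.cotangentBundle M a) (Kerr.cotangentPhotonRegion M a) :=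
  ⟨Kerr.isSmoothSubmanifold_photonRegion hsub, Kerr.isSmoothSubmanifold_cotangentPhotonRegion hsub⟩
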